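/- Let $\mathbb{K}$ be an algebraically closed field of characteristic zero, let $n\ge 1$, and let $\mathcal{A}\subset\mathbb{Z}_{\ge 0}^n$ be a finite set. For $t\ge 0$ let $t\mathcal{A}=\{a_1+\cdots+a_t \mid a_i\in\mathcal{A}\}$ (with $0\mathcal{A}=\{0\}$) and $\varphi_{\mathcal{A}}(t)=|t\mathcal{A}|$. Let $p_{\mathcal{A}}\in\mathbb{Q}[t]$ be the polynomial with $\varphi_{\mathcal{A}}(t)=p_{\mathcal{A}}(t)$ for all sufficiently large $t$, and let $n_0(\mathcal{A})$ be the least integer $N\ge 0$ such that $\varphi_{\mathcal{A}}(t)=p_{\mathcal{A}}(t)$ for all $t\ge N$. Write $|a|=a_1+\cdots+a_n$, let $d_{\mathcal{A}}$ be the least integer $\delta\ge 0$ with $|a|\le\delta$ for all $a\in\mathcal{A}$, and let $Y=Y_{n,d_{\mathcal{A}}}\subset\mathbb{P}^{|\mathcal{A}|-1}$ be the Zariski closure of the image of the rational map $\mathbb{P}^n\dashrightarrow\mathbb{P}^{|\mathcal{A}|-1}$ over $\mathbb{K}$ given by the monomials $x_0^{d_{\mathcal{A}}-|a|}x_1^{a_1}\cdots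 x_n^{a_n}$, $a\in\mathcal{A}$. The degree of a projective variety of dimension $r$ is $r!$ times the leading coefficient of its Hilbert polynomial. Assume that $\dim Y=n$, and let $d$ be the degree of $Y$. (i) If $|\mathcal{A}|=n+1$, then $\varphi_{\mathcal{A}}(t)=p_{\mathcal{A}}(t)=\binom{t+n}{n}$ for all integers $t\ge 0$. In particular, $n_0(\mathcal{A})=0$. (ii) If $|\mathcal{A}|=n+2$, then $d$ is a positive integer, $Y$ is a hypersurface of degree $d$ in $\mathbb{P}^{n+1}$ (its homogeneous ideal is generated by one irreducible form of degree $d$), $n_0(\mathcal{A})=\max\{0,\,d-n-1\}$, and for all integers $t\ge 0$ $$\varphi_{\mathcal{A}}(t)=\begin{cases}\binom{t+n+1}{n+1} & \text{if } t<d-n-1,\\[4pt] \binom{t+n+1}{n+1}-\binom{t-d+n+1}{n+1} & \text{if } t\ge d-n-1.\end{cases}$$ Moreover, $$d=n!\,\frac{\operatorname{vol}(\operatorname{conv}(\mathcal{A}))}{[\mathbb{Z}^n:\mathbb{Z}(\mathcal{A}-\mathcal{A})]},$$ where $\operatorname{conv}(\mathcal{A})\subset\mathbb{R}^n$ is the convex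 hull, $\operatorname{vol}$ is Lebesgue measure, and $\mathbb{Z}(\mathcal{A}-\mathcal{A})$ is the subgroup of $\mathbb{Z}^n$ generated by the differences $a-b$ with $a,b\in\mathcal{A}$. -/

import Mathlib

noncomputable section

namespace SumsetVariety

open Polynomial

/-! ### Sumsets -/

/-- The `t`-fold sumset `tA = {a₁ + ⋯ + a_t | aᵢ ∈ A}`; for `t = 0` it is `{0}`. -/
def sumset {n : ℕ} (A : Finset (Fin n → ℕ)) (t : ℕ) : Finset (Fin n → ℕ) :=
  (Fintype.piFinset fun _ : Fin t => A).image fun f => ∑ i, f i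

/-- The cardinality function `φ_A(t) = |tA|`. -/
def cardFun {n : ℕ} (A : Finset (Fin n → ℕ)) (t : ℕ) : ℕ :=
  (sumset A t).card

open Classical in
/-- The polynomial over `ℚ` that agrees with `f` at all sufficiently large integers, if there is
one (it is then unique); `0` otherwise. -/
def eventualPoly (f : ℕ → ℕ) : ℚ[X] :=
  if h : ∃ p : ℚ[X], ∀ᶠ t : ℕ in Filter.atTop, (f t : ℚ) = p.eval (t : ℚ) then h.choose else 0

/-- Uniqueness of the polynomial that eventually agrees with `f`. -/
theorem eventualPoly_eq {f : ℕ → ℕ} {p : ℚ[X]}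
    (hp : ∀ᶠ t : ℕ in Filter.atTop, (f t : ℚ) = p.eval (t : ℚ)) : eventualPoly f = p := by
  have h : ∃ p : ℚ[X], ∀ᶠ t : ℕ in Filter.atTop, (f t : ℚ) = p.eval (t : ℚ) := ⟨p, hp⟩
  have hq : ∀ᶠ t : ℕ in Filter.atTop, (f t : ℚ) = (eventualPoly f).eval (t : ℚ) := by
    rw [eventualPoly, dif_pos h]
    exact h.choose_spec
  obtain ⟨N, hN⟩ := Filter.eventually_atTop.1 (hp.and hq)
  refine Polynomial.eq_of_infinite_eval_eq _ _ (Set.Infinite.mono ?_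
    ((Set.Ici_infinite N).image (f := fun t : ℕ => (t : ℚ)) Nat.cast_injective.injOn))
  rintro _ ⟨t, ht, rfl⟩
  exact (hN t ht).2.symm.trans (hN t ht).1

/-- The polynomial `p_A` with `φ_A(t) = p_A(t)` for all large `t`. -/
def sumsetPoly {n : ℕ} (A : Finset (Fin n → ℕ)) : ℚ[X] :=
  eventualPoly (cardFun A)

/-- The phase transition `n₀(A)`: the least `N ≥ 0` with `φ_A(t) = p_A(t)` for all `t ≥ N`. -/
def phaseTransition {n : ℕ} (A : Finset (Fin n → ℕ)) : ℕ :=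
  sInf {N : ℕ | ∀ t : ℕ, N ≤ t → (cardFun A t : ℚ) = (sumsetPoly A).eval (t : ℚ)}

/-! ### Lattice and convex geometry of `A` -/

/-- The subgroup `ℤ(A - A)` of `ℤⁿ` generated by the differences of elements of `A`. -/
def diffSubgroup {n : ℕ} (A : Finset (Fin n → ℕ)) : AddSubgroup (Fin n → ℤ) :=
  AddSubgroup.closure {x | ∃ a ∈ A, ∃ b ∈ A, x = fun i => (a i : ℤ) - (b i : ℤ)}

/-- The convex hull `conv(A)` in `ℝⁿ`. -/
def realHull {n : ℕ} (A : Finset (Fin n → ℕ)) : Set (Fin n → ℝ) :=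
  convexHull ℝ {x | ∃ a ∈ A, x = fun i => (a i : ℝ)}

/-! ### Projective varieties -/

section Projective

variable {K : Type*} [Field K] {ι : Type*}

/-- The set of points of projective space at which all polynomials in `S` vanish (used only for
sets of homogeneous polynomials, for which the choice of the representative is irrelevant). -/
def projZeroLocus (S : Set (MvPolynomial ι K)) : Set (Projectivization K (ι → K)) :=
  {P | ∀ p ∈ S, MvPolynomial.eval P.rep p = 0}

/-- Sets of homogeneous polynomials (of possibly different degrees). -/
def IsHomogeneousSet (S : Set (MvPolynomial ι K)) : Prop :=
  ∀ p ∈ S, ∃ m : ℕ, p.IsHomogeneous m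

/-- The Zariski topology on projective space with homogeneous coordinates indexed by `ι`: the
closed sets are the zero loci of sets of homogeneous polynomials. -/
instance zariskiTopology : TopologicalSpace (Projectivization K (ι → K)) :=
  TopologicalSpace.ofClosed {Z | ∃ S, IsHomogeneousSet S ∧ Z = projZeroLocus (K := K) (ι := ι) S}
    (by
      refine ⟨{1}, fun p hp => ⟨0, ?_⟩, ?_⟩
      · rw [Set.mem_singleton_iff.1 hp]
        exact MvPolynomial.isHomogeneous_one ι K
      · ext P
        simp [projZeroLocus])
    (by
      intro T hT
      refine ⟨⋃₀ {S | IsHomogeneousSet S ∧ projZeroLocus S ∈ T}, ?_, ?_⟩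
      · rintro p ⟨S, hS, hp⟩
        exact hS.1 p hp
      · ext P
        constructor
        · rintro hP p ⟨S, hS, hp⟩
          exact hP _ hS.2 p hp
        · intro hP Z hZ
          obtain ⟨S, hS, rfl⟩ := hT hZ
          exact fun p hp => hP p ⟨S, ⟨hS, hZ⟩, hp⟩)
    (by
      rintro _ ⟨S, hS, rfl⟩ _ ⟨S', hS', rfl⟩
      refine ⟨{r | ∃ p ∈ S, ∃ q ∈ S', r = p * q}, ?_, ?_⟩
      · rintro _ ⟨p, hp, q, hq, rfl⟩
        obtain ⟨m, hm⟩ := hS p hp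
        obtain ⟨m', hm'⟩ := hS' q hq
        exact ⟨m + m', hm.mul hm'⟩
      · ext P
        constructor
        · rintro (hP | hP) _ ⟨p, hp, q, hq, rfl⟩
          · rw [map_mul, hP p hp, zero_mul]
          · rw [map_mul, hP q hq, mul_zero]
        · intro hP
          by_contra hcon
          rw [Set.mem_union, not_or] at hcon
          obtain ⟨h1, h2⟩ := hcon
          simp only [projZeroLocus, Set.mem_ofPred_eq, not_forall] at h1 h2
          obtain ⟨p, hp, hpP⟩ := h1
          obtain ⟨q, hq, hqP⟩ := h2
          have := hP (p * q) ⟨p, hp, q, hq, rfl⟩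
          rw [map_mul] at this
          exact (mul_ne_zero hpP hqP) this)

/-- The homogeneous ideal `I(X)`, generated by the homogeneous polynomials that vanish on `X`. -/
def homIdeal (X : Set (Projectivization K (ι → K))) : Ideal (MvPolynomial ι K) :=
  Ideal.span {p | (∃ m : ℕ, p.IsHomogeneous m) ∧ ∀ P ∈ X, MvPolynomial.eval P.rep p = 0}

/-- The Hilbert function of `X`: `t ↦ dim_K (S / I(X))_t`, where `S` is the polynomial ring. -/
def hilbertFun (X : Set (Projectivization K (ι → K))) (t : ℕ) : ℕ :=
  Module.finrank K ((MvPolynomial.homogeneousSubmodule ι K t).map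
    (Ideal.Quotient.mkₐ K (homIdeal X)).toLinearMap)

/-- The Hilbert polynomial of `X`. -/
def hilbertPoly (X : Set (Projectivization K (ι → K))) : ℚ[X] :=
  eventualPoly (hilbertFun X)

/-- The degree of `X`: if `r` is the dimension of `X` (the Krull dimension of `X` with its Zariski
topology), then the degree is `r!` times the leading coefficient of the Hilbert polynomial. -/
def degree (X : Set (Projectivization K (ι → K))) : ℚ :=
  (Nat.factorial (WithBot.unbotD 0 (topologicalKrullDim X)).toNat : ℚ) *
    (hilbertPoly X).leadingCoeff

/-- `X` is a hypersurface of degree `m`: its homogeneous ideal is generated by one irreducible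
homogeneous polynomial of degree `m`. -/
def IsHypersurface (X : Set (Projectivization K (ι → K))) (m : ℕ) : Prop :=
  IsClosed X ∧ ∃ F : MvPolynomial ι K,
    F.IsHomogeneous m ∧ Irreducible F ∧ homIdeal X = Ideal.span {F}

end Projective

/-! ### The monomial projection associated with `A` -/

/-- `d_A`: the least `δ ≥ 0` with `a₁ + ⋯ + aₙ ≤ δ` for all `a ∈ A`. -/
def maxDegree {n : ℕ} (A : Finset (Fin n → ℕ)) : ℕ :=
  A.sup fun a => ∑ i, a i

/-- The monomial `x₀ ^ (d_A - a₁ - ⋯ - aₙ) * x₁ ^ a₁ * ⋯ * xₙ ^ aₙ` of degree `d_A`. -/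
def monomialOf (K : Type*) [Field K] {n : ℕ} (A : Finset (Fin n → ℕ)) (a : Fin n → ℕ) :
    MvPolynomial (Fin (n + 1)) K :=
  MvPolynomial.X 0 ^ (maxDegree A - ∑ i, a i) * ∏ i : Fin n, MvPolynomial.X i.succ ^ a i

/-- The values at `x` of the monomials attached to the elements of `A`. -/
def monomialValues (K : Type*) [Field K] {n : ℕ} (A : Finset (Fin n → ℕ))
    (x : Fin (n + 1) → K) : A → K :=
  fun a => MvPolynomial.eval x (monomialOf K A a)

/-- The variety `Y_{n,d_A}` in the projective space of dimension `|A| - 1`, with coordinates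
indexed by `A`: the Zariski closure of the image of the rational map on the projective `n`-space
given by the monomials attached to `A`, which is defined at the points where these monomials do
not all vanish. -/
def monomialVariety (K : Type*) [Field K] {n : ℕ} (A : Finset (Fin n → ℕ)) :
    Set (Projectivization K (A → K)) :=
  closure {P | ∃ x : Projectivization K (Fin (n + 1) → K),
    ∃ hx : monomialValues K A x.rep ≠ 0, P = Projectivization.mk K (monomialValues K A x.rep) hx}

end SumsetVariety

end

noncomputable section

namespace SumsetVariety

open Polynomial

/-! ### Hilbert functions and irreducible closed sets -/

/-! A form vanishes on `Y` exactly when the substitution of the monomials of `A` for its variables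
kills it. Monomials with distinct exponents are linearly independent, so the Hilbert function of `Y`
is the counting function of the sumsets (`hilbertFun_monomialVariety`), and the geometry becomes the
combinatorics of affine relations between the points of `A`.

The dimension hypothesis enters only through growth. A chain of `n + 1` irreducible closed sets
forces the Hilbert function to grow at least like a multiple of `t ^ n`, whereas points on an affine
hyperplane have sumsets of size `O(t ^ (n - 1))`. Hence `A` affinely spans and its relations have
rank `|A| - n - 1`.

With `n + 1` points there is no relation, and sums correspond to multisets. With `n + 2` points the
integral relations are the multiples of one primitive `u = p - q`, with `p`, `q` of disjoint support
and equal degree `d`. The toric ideal is then generated by `x^p - x^q` (`ker_toricMap`), and the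
monomials not divisible by `x^p` represent each sum once. Counting them gives the formulas, and the
Hilbert polynomial has leading coefficient `d / n!`.

For the volume, `tA` agrees, up to a bounded change of `t`, with the points of a translate of the
lattice `ℤ(A - A)` in `t • conv(A)`. Comparing asymptotics as `t → ∞` identifies `d / n!` with
volume over index. -/

theorem finrank_map_congr {K V V₁ V₂ : Type*} [Field K] [AddCommGroup V] [Module K V]
    [AddCommGroup V₁] [Module K V₁] [AddCommGroup V₂] [Module K V₂] (W : Submodule K V)
    (f : V →ₗ[K] V₁) (g : V →ₗ[K] V₂) (h : ∀ x ∈ W, f x = 0 ↔ g x = 0) :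
    Module.finrank K (W.map f) = Module.finrank K (W.map g) := by
  have hker : LinearMap.ker (f.domRestrict W) = LinearMap.ker (g.domRestrict W) := by
    ext x
    simpa using h x x.2
  rw [← LinearMap.range_domRestrict, ← LinearMap.range_domRestrict,
    ← (f.domRestrict W).quotKerEquivRange.finrank_eq,
    ← (g.domRestrict W).quotKerEquivRange.finrank_eq, hker]

section Projective

variable {K : Type*} [Field K] {ι : Type*}

theorem eval_rep_eq_zero_of_mem_homIdeal {X : Set (Projectivization K (ι → K))}
    {p : MvPolynomial ι K} (hp : p ∈ homIdeal X) {P : Projectivization K (ι → K)} (hP : P ∈ X) :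
    MvPolynomial.eval P.rep p = 0 := by
  have : homIdeal X ≤ RingHom.ker (MvPolynomial.eval P.rep) :=
    Ideal.span_le.2 fun q hq => hq.2 P hP
  exact this hp

theorem mem_homIdeal_iff {X : Set (Projectivization K (ι → K))} {p : MvPolynomial ι K} {t : ℕ}
    (hp : p.IsHomogeneous t) :
    p ∈ homIdeal X ↔ ∀ P ∈ X, MvPolynomial.eval P.rep p = 0 :=
  ⟨fun h _ hP => eval_rep_eq_zero_of_mem_homIdeal h hP,
    fun h => Ideal.subset_span ⟨⟨t, hp⟩, h⟩⟩

/-- Evaluation of polynomials at the chosen representatives of the points of `X`. -/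
def evalOn (X : Set (Projectivization K (ι → K))) : MvPolynomial ι K →ₗ[K] (X → K) :=
  LinearMap.pi fun P => (MvPolynomial.aeval (R := K) P.1.rep).toLinearMap

@[simp]
theorem evalOn_apply (X : Set (Projectivization K (ι → K))) (p : MvPolynomial ι K) (P : X) :
    evalOn X p P = MvPolynomial.eval P.1.rep p := by
  simp [evalOn]

theorem evalOn_eq_zero_iff {X : Set (Projectivization K (ι → K))} {p : MvPolynomial ι K} :
    evalOn X p = 0 ↔ ∀ P ∈ X, MvPolynomial.eval P.rep p = 0 := by
  simp [funext_iff]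

/-- The quotient by the ideal may be replaced by any linear map with the same kernel in degree `t`:
evaluation at points for the growth bounds, the monomial substitution for counting. -/
theorem hilbertFun_eq_of_forall {V : Type*} [AddCommGroup V] [Module K V]
    {X : Set (Projectivization K (ι → K))} {t : ℕ} (f : MvPolynomial ι K →ₗ[K] V)
    (hf : ∀ p : MvPolynomial ι K, p.IsHomogeneous t →
      ((∀ P ∈ X, MvPolynomial.eval P.rep p = 0) ↔ f p = 0)) :
    hilbertFun X t = Module.finrank K ((MvPolynomial.homogeneousSubmodule ι K t).map f) := by
  refine finrank_map_congr _ _ _ fun p hp => ?_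
  rw [← hf p hp, ← mem_homIdeal_iff hp]
  simp [Ideal.Quotient.eq_zero_iff_mem]

theorem hilbertFun_eq_finrank_evalOn (X : Set (Projectivization K (ι → K))) (t : ℕ) :
    hilbertFun X t =
      Module.finrank K ((MvPolynomial.homogeneousSubmodule ι K t).map (evalOn X)) :=
  hilbertFun_eq_of_forall _ fun _ _ => evalOn_eq_zero_iff.symm

instance finite_map_homogeneousSubmodule [Finite ι] {V : Type*} [AddCommGroup V] [Module K V]
    (f : MvPolynomial ι K →ₗ[K] V) (t : ℕ) :
    Module.Finite K ((MvPolynomial.homogeneousSubmodule ι K t).map f) :=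
  Module.Finite.iff_fg.2 ((MvPolynomial.homogeneousSubmodule_fg ι K t).map f)

theorem hilbertFun_mono [Finite ι] {X Y : Set (Projectivization K (ι → K))} (h : X ⊆ Y) (t : ℕ) :
    hilbertFun X t ≤ hilbertFun Y t := by
  rw [hilbertFun_eq_finrank_evalOn, hilbertFun_eq_finrank_evalOn]
  have : evalOn X = (LinearMap.funLeft K K (Set.inclusion h)) ∘ₗ evalOn Y := by
    ext p P
    simp [LinearMap.funLeft]
  rw [this, Submodule.map_comp]
  exact Submodule.finrank_map_le _ _

theorem one_le_hilbertFun [Finite ι] {X : Set (Projectivization K (ι → K))} (hX : X.Nonempty)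
    (t : ℕ) : 1 ≤ hilbertFun X t := by
  obtain ⟨P, hP⟩ := hX
  obtain ⟨i, hi⟩ := Function.ne_iff.1 P.rep_nonzero
  rw [hilbertFun_eq_finrank_evalOn, Nat.one_le_iff_ne_zero, ← Nat.pos_iff_ne_zero,
    Module.finrank_pos_iff_exists_ne_zero]
  refine ⟨⟨evalOn X (MvPolynomial.X i ^ t),
    Submodule.mem_map_of_mem (MvPolynomial.isHomogeneous_X_pow i t)⟩, fun h => ?_⟩
  have := congr_fun (congr_arg Subtype.val h) ⟨P, hP⟩
  simp only [evalOn_apply, map_pow, MvPolynomial.eval_X] at this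
  exact pow_ne_zero t hi (by simpa using this)

theorem isClosed_iff_exists_projZeroLocus {X : Set (Projectivization K (ι → K))} :
    IsClosed X ↔ ∃ S, IsHomogeneousSet S ∧ X = projZeroLocus S := by
  rw [← isOpen_compl_iff]
  change Xᶜᶜ ∈ {Z | ∃ S, IsHomogeneousSet S ∧ Z = projZeroLocus (K := K) (ι := ι) S} ↔ _
  rw [compl_compl, Set.mem_ofPred_eq]

theorem isClosed_setOf_eval_rep_eq_zero {p : MvPolynomial ι K} {t : ℕ} (hp : p.IsHomogeneous t) :
    IsClosed {P : Projectivization K (ι → K) | MvPolynomial.eval P.rep p = 0} := by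
  refine isClosed_iff_exists_projZeroLocus.2 ⟨{p}, fun q hq => ⟨t, ?_⟩, ?_⟩
  · rwa [Set.mem_singleton_iff.1 hq]
  · simp [projZeroLocus]

theorem exists_homogeneous_separating {X Y : Set (Projectivization K (ι → K))} (hX : IsClosed X)
    (hXne : X.Nonempty) (hY : ¬ Y ⊆ X) :
    ∃ m : ℕ, 1 ≤ m ∧ ∃ f : MvPolynomial ι K, f.IsHomogeneous m ∧
      (∀ P ∈ X, MvPolynomial.eval P.rep f = 0) ∧ ∃ P ∈ Y, MvPolynomial.eval P.rep f ≠ 0 := by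
  obtain ⟨S, hS, rfl⟩ := isClosed_iff_exists_projZeroLocus.1 hX
  obtain ⟨P, hPY, hP⟩ := Set.not_subset.1 hY
  simp only [projZeroLocus, Set.mem_ofPred_eq, not_forall] at hP
  obtain ⟨f, hfS, hf⟩ := hP
  obtain ⟨m, hm⟩ := hS f hfS
  refine ⟨m, ?_, f, hm, fun Q hQ => hQ f hfS, P, hPY, hf⟩
  -- A form of degree zero is constant, so it cannot vanish on the nonempty `X` and be nonzero
  -- elsewhere.
  by_contra hm0
  obtain rfl : m = 0 := by omega
  obtain ⟨Q, hQ⟩ := hXne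
  have hc := MvPolynomial.totalDegree_eq_zero_iff_eq_C.1
    ((MvPolynomial.totalDegree_zero_iff_isHomogeneous _).2 hm)
  have h1 := hQ f hfS
  rw [hc, MvPolynomial.eval_C] at h1 hf
  exact hf h1

/-- Irreducibility of `Y` makes multiplication by `f` injective on restrictions of forms to `Y`, and
the products lie in the kernel of restriction to `X`; rank–nullity gives the inequality. -/
theorem hilbertFun_add_le_of_isIrreducible [Finite ι] {X Y : Set (Projectivization K (ι → K))}
    (hXY : X ⊆ Y) (hY : IsIrreducible Y) {m : ℕ} {f : MvPolynomial ι K} (hf : f.IsHomogeneous m)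
    (hfX : ∀ P ∈ X, MvPolynomial.eval P.rep f = 0)
    (hfY : ∃ P ∈ Y, MvPolynomial.eval P.rep f ≠ 0) (t : ℕ) :
    hilbertFun X (t + m) + hilbertFun Y t ≤ hilbertFun Y (t + m) := by
  set V := (MvPolynomial.homogeneousSubmodule ι K (t + m)).map (evalOn Y)
  set W := (MvPolynomial.homogeneousSubmodule ι K t).map (evalOn Y)
  let r : (Y → K) →ₗ[K] (X → K) := LinearMap.funLeft K K (Set.inclusion hXY)
  let μ : (Y → K) →ₗ[K] (Y → K) := LinearMap.mulLeft K (evalOn Y f)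
  have hr : evalOn X = r ∘ₗ evalOn Y := by
    ext p P
    simp [r, LinearMap.funLeft]
  have hX : hilbertFun X (t + m) = Module.finrank K (V.map r) := by
    rw [hilbertFun_eq_finrank_evalOn, hr, Submodule.map_comp]
  have hinj : ∀ p : MvPolynomial ι K, p.IsHomogeneous t →
      (evalOn Y p = 0 ↔ (μ ∘ₗ evalOn Y) p = 0) := by
    intro p hp
    refine ⟨fun h => by simp [h], fun h => evalOn_eq_zero_iff.2 ?_⟩
    have hsub : Y ⊆ {P | MvPolynomial.eval P.rep f = 0} ∪ {P | MvPolynomial.eval P.rep p = 0} := by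
      intro P hP
      have := congr_fun h ⟨P, hP⟩
      simpa [μ] using this
    rcases (isPreirreducible_iff_isClosed_union_isClosed.1 hY.isPreirreducible) _ _
      (isClosed_setOf_eval_rep_eq_zero hf) (isClosed_setOf_eval_rep_eq_zero hp) hsub with h1 | h1
    · obtain ⟨P, hP, hne⟩ := hfY
      exact absurd (h1 hP) hne
    · exact fun P hP => h1 hP
  have hWY : hilbertFun Y t = Module.finrank K (W.map μ) := by
    rw [hilbertFun_eq_finrank_evalOn, finrank_map_congr _ _ _ hinj, Submodule.map_comp]
  have hle : W.map μ ≤ V := by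
    rintro _ ⟨_, ⟨p, hp, rfl⟩, rfl⟩
    refine ⟨f * p, ?_, ?_⟩
    · have := hf.mul (show p.IsHomogeneous t from hp)
      rwa [add_comm] at this
    · ext P; simp [μ]
  have hker : W.map μ ≤ LinearMap.ker r := by
    rintro _ ⟨_, ⟨p, hp, rfl⟩, rfl⟩
    rw [LinearMap.mem_ker]
    ext P
    simp [r, μ, LinearMap.funLeft, hfX P.1 P.2]
  have hrn := LinearMap.finrank_range_add_finrank_ker (r.domRestrict V)
  rw [LinearMap.range_domRestrict] at hrn
  have hk : Module.finrank K (W.map μ) ≤ Module.finrank K (LinearMap.ker (r.domRestrict V)) := by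
    refine LinearMap.finrank_le_finrank_of_injective
      (f := LinearMap.codRestrict _ (Submodule.inclusion hle) fun x => ?_) ?_
    · exact hker x.2
    · intro x y hxy
      have := congr_arg (fun z => (z.1 : V).1) hxy
      exact Subtype.ext this
  have hV : hilbertFun Y (t + m) = Module.finrank K V := hilbertFun_eq_finrank_evalOn _ _
  rw [hX, hWY, hV]
  omega

/-- Advancing `t` by `m * M` raises `t / (m * M)` by one and `H'` by at least one value of `H`,
which is Pascal's rule. Thus each step of a chain of irreducible sets adds one to the order of
growth. -/
theorem choose_div_le_of_recursion {H H' : ℕ → ℕ} {k M m : ℕ} (hM : 1 ≤ M) (hm : 1 ≤ m)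
    (hH : ∀ t, (t / M).choose k ≤ H t) (hrec : ∀ t, H (t + m) + H' t ≤ H' (t + m)) (t : ℕ) :
    (t / (m * M)).choose (k + 1) ≤ H' t := by
  have hmono : ∀ j t, H' t ≤ H' (t + j * m) := by
    intro j
    induction j with
    | zero => simp
    | succ j ih =>
      intro t
      have := hrec (t + j * m)
      have := ih t
      rw [Nat.succ_mul, ← add_assoc]
      omega
  have hpos : 0 < m * M := Nat.mul_pos hm hM
  induction t using Nat.strong_induction_on with
  | _ t ih =>
    rcases lt_or_ge t (m * M) with h | h
    · simp [Nat.div_eq_of_lt h]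
    · obtain ⟨s, rfl⟩ := Nat.exists_eq_add_of_le' h
      have h1 := ih s (by omega)
      have h2 := hmono (M - 1) s
      have h3 := hrec (s + (M - 1) * m)
      have h4 : s + (M - 1) * m + m = s + m * M := by
        obtain ⟨M, rfl⟩ := Nat.exists_eq_add_of_le' hM
        simp; ring
      rw [h4] at h3
      have h5 := hH (s + m * M)
      have h6 : (s / (m * M)).choose k ≤ ((s + m * M) / M).choose k := by
        refine Nat.choose_le_choose _ ((Nat.div_le_div_left (Nat.le_mul_of_pos_left M hm) hM).trans
          (Nat.div_le_div_right (by omega)))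
      rw [Nat.add_div_right _ hpos, Nat.choose_succ_succ']
      omega

theorem exists_choose_div_le_hilbertFun_of_series [Finite ι]
    (p : LTSeries (TopologicalSpace.IrreducibleCloseds (Projectivization K (ι → K)))) (i : ℕ)
    (hi : i < p.length + 1) :
    ∃ M : ℕ, 1 ≤ M ∧ ∀ t, (t / M).choose i ≤ hilbertFun (p ⟨i, hi⟩ : Set (Projectivization K (ι → K))) t := by
  induction i with
  | zero => exact ⟨1, le_rfl, fun t => by simpa using one_le_hilbertFun (p _).isIrreducible.1 t⟩
  | succ i ih =>
    obtain ⟨M, hM, hH⟩ := ih (by omega)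
    have hlt : p ⟨i, by omega⟩ < p ⟨i + 1, hi⟩ := p.strictMono (by simp)
    obtain ⟨m, hm, f, hf, hfX, hfY⟩ := exists_homogeneous_separating
      (p ⟨i, by omega⟩).isClosed (p ⟨i, by omega⟩).isIrreducible.1
      (Y := (p ⟨i + 1, hi⟩ : Set _)) (fun h => hlt.not_ge h)
    exact ⟨m * M, Nat.mul_pos hm hM, choose_div_le_of_recursion hM hm hH
      (hilbertFun_add_le_of_isIrreducible hlt.le (p ⟨i + 1, hi⟩).isIrreducible hf hfX hfY)⟩

theorem exists_choose_div_le_hilbertFun [Finite ι] {Y : Set (Projectivization K (ι → K))} {n : ℕ}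
    (hY : IsClosed Y) (hdim : (n : WithBot ℕ∞) ≤ topologicalKrullDim Y) :
    ∃ M : ℕ, 1 ≤ M ∧ ∀ t, (t / M).choose n ≤ hilbertFun Y t := by
  obtain ⟨p, rfl⟩ := Order.le_krullDim_iff.1 hdim
  let q := p.map (TopologicalSpace.IrreducibleCloseds.map _ continuous_subtype_val)
    (TopologicalSpace.IrreducibleCloseds.map_strictMono_of_isInducing
      Topology.IsInducing.subtypeVal)
  obtain ⟨M, hM, hH⟩ := exists_choose_div_le_hilbertFun_of_series q p.length (Nat.lt_succ_self _)
  refine ⟨M, hM, fun t => (hH t).trans (hilbertFun_mono ?_ t)⟩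
  change closure (Subtype.val '' _) ⊆ Y
  exact closure_minimal (by simp) hY

end Projective

/-! ### Maps given by monomials -/

section Toric

variable (K : Type*) [Field K] {κ τ : Type*}

/-- The algebra homomorphism of polynomial rings which maps the variable with index `a` to the
monomial with exponent `e a`. -/
def toricMap (e : κ → τ →₀ ℕ) : MvPolynomial κ K →ₐ[K] MvPolynomial τ K :=
  MvPolynomial.aeval fun a => MvPolynomial.monomial (e a) 1

theorem toricMap_monomial (e : κ → τ →₀ ℕ) (v : κ →₀ ℕ) (c : K) :
    toricMap K e (MvPolynomial.monomial v c) =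
      MvPolynomial.monomial (Finsupp.linearCombination ℕ e v) c := by
  rw [toricMap, MvPolynomial.aeval_monomial, Finsupp.linearCombination_apply,
    MvPolynomial.algebraMap_eq]
  simp only [MvPolynomial.monomial_pow, one_pow]
  rw [Finsupp.prod, ← MvPolynomial.monomial_sum_one, MvPolynomial.C_mul_monomial, mul_one,
    Finsupp.sum]

theorem homogeneousSubmodule_eq_span (t : ℕ) :
    MvPolynomial.homogeneousSubmodule κ K t =
      Submodule.span K ((fun v => MvPolynomial.monomial v (1 : K)) '' {v | v.degree = t}) := by
  rw [MvPolynomial.homogeneousSubmodule_eq_finsupp_supported]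
  exact AddMonoidAlgebra.supported_eq_span_single _ _

/-- The image is spanned by the monomials with exponents in `E`, which are part of a basis. -/
theorem finrank_map_toricMap (e : κ → τ →₀ ℕ) (t : ℕ) :
    Module.finrank K ((MvPolynomial.homogeneousSubmodule κ K t).map (toricMap K e).toLinearMap) =
      (Finsupp.linearCombination ℕ e '' {v | v.degree = t}).ncard := by
  set E := Finsupp.linearCombination ℕ e '' {v | v.degree = t}
  have h : (MvPolynomial.homogeneousSubmodule κ K t).map (toricMap K e).toLinearMap =
      Submodule.span K (MvPolynomial.basisMonomials τ K '' E) := by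
    rw [homogeneousSubmodule_eq_span, Submodule.map_span, Set.image_image, Set.image_image]
    simp [toricMap_monomial]
  rw [h, Module.finrank, ← Set.ncard_image_of_injective E
    (MvPolynomial.basisMonomials τ K).injective,
    rank_span_set ((MvPolynomial.basisMonomials τ K).linearIndependent.linearIndepOn_id.mono
      (Set.image_subset_range _ _))]
  rfl

end Toric

theorem eval_smul_of_isHomogeneous {K ι : Type*} [Field K] {p : MvPolynomial ι K} {m : ℕ}
    (hp : p.IsHomogeneous m) (c : K) (x : ι → K) :
    MvPolynomial.eval (c • x) p = c ^ m * MvPolynomial.eval x p := by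
  rw [MvPolynomial.eval_eq, MvPolynomial.eval_eq, Finset.mul_sum]
  refine Finset.sum_congr rfl fun d hd => ?_
  have hdeg := hp.degree_eq_sum_deg_support hd
  simp only [Pi.smul_apply, smul_eq_mul, mul_pow, Finset.prod_mul_distrib, Finset.prod_pow_eq_pow_sum]
  rw [hdeg]
  ring

theorem eval_smul_eq_zero_iff {K ι : Type*} [Field K] {p : MvPolynomial ι K} {m : ℕ}
    (hp : p.IsHomogeneous m) {c : K} (hc : c ≠ 0) (x : ι → K) :
    MvPolynomial.eval (c • x) p = 0 ↔ MvPolynomial.eval x p = 0 := by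
  rw [eval_smul_of_isHomogeneous hp, mul_eq_zero, or_iff_right (pow_ne_zero m hc)]

/-! ### Sumsets as Hilbert functions of monomial varieties -/

section Sumset

variable {n : ℕ} (A : Finset (Fin n → ℕ))

/-- The sum of the elements of `A` with the multiplicities prescribed by a vector in `ℕ^A`. -/
def weightedSum : (A →₀ ℕ) →ₗ[ℕ] (Fin n → ℕ) :=
  Finsupp.linearCombination ℕ (Subtype.val : A → Fin n → ℕ)

theorem mem_sumset_iff {t : ℕ} {b : Fin n → ℕ} :
    b ∈ sumset A t ↔ ∃ v : A →₀ ℕ, v.degree = t ∧ weightedSum A v = b := by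
  constructor
  · intro hb
    simp only [sumset, Finset.mem_image, Fintype.mem_piFinset] at hb
    obtain ⟨f, hf, rfl⟩ := hb
    refine ⟨∑ i, Finsupp.single ⟨f i, hf i⟩ 1, by simp, ?_⟩
    simp [weightedSum]
  · rintro ⟨v, rfl, rfl⟩
    have key : ∀ (l : List A), (l.map Subtype.val).sum ∈ sumset A l.length := by
      intro l
      simp only [sumset, Finset.mem_image, Fintype.mem_piFinset]
      refine ⟨fun i => (l.get i).1, fun i => (l.get i).2, ?_⟩
      rw [← List.sum_ofFn]
      congr 1
      exact List.ofFn_getElem_eq_map l Subtype.val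
    have hl := key (Finsupp.toMultiset v).toList
    have h1 : (Finsupp.toMultiset v).toList.length = v.degree := by
      rw [Multiset.length_toList, Finsupp.card_toMultiset]; rfl
    have h2 : ((Finsupp.toMultiset v).toList.map Subtype.val).sum = weightedSum A v := by
      rw [← Multiset.sum_coe, ← Multiset.map_coe, Multiset.coe_toList]
      clear hl h1
      induction v using Finsupp.induction_linear with
      | zero => simp
      | add v w hv hw => rw [map_add, Multiset.map_add, Multiset.sum_add, hv, hw, map_add]
      | single a k => simp [weightedSum, Multiset.map_nsmul, Multiset.sum_nsmul]
    rwa [h1, h2] at hl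

theorem coe_sumset (t : ℕ) :
    (sumset A t : Set (Fin n → ℕ)) = weightedSum A '' {v | v.degree = t} := by
  ext b
  simpa using mem_sumset_iff A

/-- The exponent of the monomial of degree `d_A` attached to an element of `A`. -/
def homExponent (a : A) : Fin (n + 1) →₀ ℕ :=
  Finsupp.equivFunOnFinite.symm (Fin.cons (maxDegree A - ∑ i, a.1 i) a.1)

theorem monomialOf_eq (K : Type*) [Field K] (a : A) :
    monomialOf K A a = MvPolynomial.monomial (homExponent A a) 1 := by
  rw [MvPolynomial.monomial_eq, Finsupp.prod_fintype _ _ (by simp), Fin.prod_univ_succ]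
  simp [monomialOf, homExponent]

theorem degree_homExponent (a : A) : (homExponent A a).degree = maxDegree A := by
  have : ∑ i, a.1 i ≤ maxDegree A := Finset.le_sup (f := fun a => ∑ i, a i) a.2
  rw [Finsupp.degree_eq_sum, Fin.sum_univ_succ]
  simp [homExponent]
  omega

theorem linearCombination_homExponent_succ (v : A →₀ ℕ) (i : Fin n) :
    Finsupp.linearCombination ℕ (homExponent A) v i.succ = weightedSum A v i := by
  simp [weightedSum, Finsupp.linearCombination_apply, Finsupp.sum, homExponent,
    Finsupp.finsetSum_apply]

theorem degree_linearCombination_homExponent (v : A →₀ ℕ) :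
    (Finsupp.linearCombination ℕ (homExponent A) v).degree = v.degree * maxDegree A := by
  rw [Finsupp.linearCombination_apply, Finsupp.sum, map_sum]
  simp only [map_nsmul, degree_homExponent, smul_eq_mul, Finsupp.degree_apply v, Finset.sum_mul]

/-- The exponent of `x₀` carries no information of its own: it is fixed by the other exponents and
the total degree. -/
theorem linearCombination_homExponent_eq_of_degree_eq {v w : A →₀ ℕ} (h : v.degree = w.degree)
    (hs : weightedSum A v = weightedSum A w) :
    Finsupp.linearCombination ℕ (homExponent A) v =
      Finsupp.linearCombination ℕ (homExponent A) w := by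
  have h0 : ∀ i : Fin n, Finsupp.linearCombination ℕ (homExponent A) v i.succ =
      Finsupp.linearCombination ℕ (homExponent A) w i.succ := by
    simp [linearCombination_homExponent_succ, hs]
  have h1 := degree_linearCombination_homExponent A v
  rw [h, ← degree_linearCombination_homExponent A w, Finsupp.degree_eq_sum, Finsupp.degree_eq_sum,
    Fin.sum_univ_succ, Fin.sum_univ_succ, Finset.sum_congr rfl fun i _ => h0 i] at h1
  ext i
  refine Fin.cases ?_ h0 i
  omega

theorem weightedSum_eq_of_linearCombination_eq {v w : A →₀ ℕ}
    (h : Finsupp.linearCombination ℕ (homExponent A) v =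
      Finsupp.linearCombination ℕ (homExponent A) w) : weightedSum A v = weightedSum A w := by
  ext i
  rw [← linearCombination_homExponent_succ, h, linearCombination_homExponent_succ]

theorem degree_eq_of_linearCombination_eq (hA : maxDegree A ≠ 0) {v w : A →₀ ℕ}
    (h : Finsupp.linearCombination ℕ (homExponent A) v =
      Finsupp.linearCombination ℕ (homExponent A) w) : v.degree = w.degree := by
  have := congr_arg Finsupp.degree h
  rwa [degree_linearCombination_homExponent, degree_linearCombination_homExponent,
    Nat.mul_left_inj hA] at this

theorem ncard_image_homExponent (t : ℕ) :
    (Finsupp.linearCombination ℕ (homExponent A) '' {v | v.degree = t}).ncard = cardFun A t := by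
  rw [cardFun, ← Set.ncard_coe_finset, coe_sumset]
  have : weightedSum A '' {v | v.degree = t} = (fun (m : Fin (n + 1) →₀ ℕ) (i : Fin n) => m i.succ) ''
      (Finsupp.linearCombination ℕ (homExponent A) '' {v | v.degree = t}) := by
    rw [Set.image_image]
    refine Set.image_congr fun v _ => ?_
    ext i
    rw [linearCombination_homExponent_succ]
  rw [this]
  refine (Set.InjOn.ncard_image ?_).symm
  rintro _ ⟨v, hv, rfl⟩ _ ⟨w, hw, rfl⟩ h
  refine linearCombination_homExponent_eq_of_degree_eq A (hv.trans hw.symm) ?_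
  ext i
  simpa [linearCombination_homExponent_succ] using congr_fun h i

variable (K : Type*) [Field K]

theorem eval_monomialValues (x : Fin (n + 1) → K) (p : MvPolynomial A K) :
    MvPolynomial.eval (monomialValues K A x) p =
      MvPolynomial.eval x (toricMap K (homExponent A) p) := by
  induction p using MvPolynomial.induction_on with
  | C c => simp
  | add p q hp hq => simp [hp, hq]
  | mul_X p a hp => simp [hp, monomialValues, monomialOf_eq, toricMap]

theorem isHomogeneous_toricMap {t : ℕ} {p : MvPolynomial A K} (hp : p.IsHomogeneous t) :
    (toricMap K (homExponent A) p).IsHomogeneous (maxDegree A * t) :=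
  hp.aeval _ fun a => MvPolynomial.isHomogeneous_monomial _ (degree_homExponent A a)

theorem monomialValues_ne_zero (hA : A.Nonempty) {x : Fin (n + 1) → K} (hx : ∀ i, x i ≠ 0) :
    monomialValues K A x ≠ 0 := by
  obtain ⟨a, ha⟩ := hA
  refine Function.ne_iff.2 ⟨⟨a, ha⟩, ?_⟩
  simp [monomialValues, monomialOf, hx, Finset.prod_ne_zero_iff]

/-- By homogeneity the choice of representatives does not matter, and over an infinite field the
points with all coordinates nonzero already detect a polynomial. The converse passes to the closure
because the zero set of a form is closed. -/
theorem vanishes_on_monomialVariety_iff [Infinite K] (hA : A.Nonempty) {t : ℕ}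
    {p : MvPolynomial A K} (hp : p.IsHomogeneous t) :
    (∀ P ∈ monomialVariety K A, MvPolynomial.eval P.rep p = 0) ↔
      toricMap K (homExponent A) p = 0 := by
  constructor
  · intro h
    have key : ∀ x : Fin (n + 1) → K, (∀ i, x i ≠ 0) →
        MvPolynomial.eval x (toricMap K (homExponent A) p) = 0 := by
      intro x hx
      have hx0 : x ≠ 0 := fun h0 => hx 0 (congr_fun h0 0)
      obtain ⟨c, hc⟩ := Projectivization.exists_smul_eq_mk_rep K x hx0
      have hne : monomialValues K A (Projectivization.mk K x hx0).rep ≠ 0 := by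
        refine monomialValues_ne_zero A K hA fun i => ?_
        rw [← hc]
        simp [Units.smul_def, hx i]
      have := h _ (subset_closure ⟨Projectivization.mk K x hx0, hne, rfl⟩)
      obtain ⟨c', hc'⟩ := Projectivization.exists_smul_eq_mk_rep K _ hne
      rwa [← hc', Units.smul_def, eval_smul_eq_zero_iff hp c'.ne_zero, eval_monomialValues, ← hc,
        Units.smul_def, eval_smul_eq_zero_iff (isHomogeneous_toricMap A K hp) c.ne_zero] at this
    -- The product of all the variables absorbs the points with a zero coordinate, so the product
    -- polynomial vanishes at every point.
    have hmul : toricMap K (homExponent A) p * ∏ i, MvPolynomial.X i = 0 := by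
      refine MvPolynomial.funext fun x => ?_
      by_cases hx : ∀ i, x i ≠ 0
      · simp [key x hx]
      · push Not at hx
        obtain ⟨i, hi⟩ := hx
        have : ∏ i, x i = 0 := Finset.prod_eq_zero (Finset.mem_univ i) hi
        simp [this]
    refine (mul_eq_zero.1 hmul).resolve_right ?_
    exact Finset.prod_ne_zero_iff.2 fun i _ => MvPolynomial.X_ne_zero i
  · intro h
    have hsub : monomialVariety K A ⊆ {P | MvPolynomial.eval P.rep p = 0} := by
      refine closure_minimal ?_ (isClosed_setOf_eval_rep_eq_zero hp)
      rintro _ ⟨x, hx, rfl⟩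
      obtain ⟨c, hc⟩ := Projectivization.exists_smul_eq_mk_rep K _ hx
      rw [Set.mem_ofPred_eq, ← hc, Units.smul_def, eval_smul_eq_zero_iff hp c.ne_zero,
        eval_monomialValues, h, map_zero]
    exact fun P hP => hsub hP

theorem hilbertFun_monomialVariety [Infinite K] (hA : A.Nonempty) :
    hilbertFun (monomialVariety K A) = cardFun A := by
  ext t
  rw [hilbertFun_eq_of_forall (toricMap K (homExponent A)).toLinearMap
    fun p hp => vanishes_on_monomialVariety_iff A K hA hp, finrank_map_toricMap,
    ncard_image_homExponent]

end Sumset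

/-! ### Affine relations -/

section Relations

variable {n : ℕ} (A : Finset (Fin n → ℕ))

theorem sum_mul_weightedSum {R : Type*} [CommSemiring R] {w : Fin n → R} {c : R}
    (h : ∀ a ∈ A, ∑ i, w i * (a i : R) = c) (v : A →₀ ℕ) :
    ∑ i, w i * (weightedSum A v i : R) = v.degree * c := by
  induction v using Finsupp.induction_linear with
  | zero => simp
  | add v v' hv hv' => simp [mul_add, add_mul, Finset.sum_add_distrib, hv, hv']
  | single a k =>
    rw [← h a.1 a.2, Finset.mul_sum]
    refine Finset.sum_congr rfl fun i _ => ?_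
    simp [weightedSum]
    exact mul_left_comm _ _ _

theorem weightedSum_apply_le (v : A →₀ ℕ) (i : Fin n) :
    weightedSum A v i ≤ v.degree * maxDegree A := by
  rw [← linearCombination_homExponent_succ, ← degree_linearCombination_homExponent]
  exact Finsupp.le_degree _ _

/-- The functional takes the single value `t * c` on `tA`, so a coordinate with nonzero weight is
determined by the other `m`, each of which is at most `t * maxDegree A`. -/
theorem cardFun_le_of_functional {m : ℕ} (A : Finset (Fin (m + 1) → ℕ)) {w : Fin (m + 1) → ℚ}
    {c : ℚ} (h : ∀ a ∈ A, ∑ i, w i * (a i : ℚ) = c) (hw : w ≠ 0) (t : ℕ) :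
    cardFun A t ≤ (t * maxDegree A + 1) ^ m := by
  obtain ⟨i, hi⟩ := Function.ne_iff.1 hw
  have hcard : (t * maxDegree A + 1) ^ m =
      (Fintype.piFinset fun _ : Fin m => Finset.range (t * maxDegree A + 1)).card := by simp
  rw [hcard, cardFun]
  refine Finset.card_le_card_of_injOn (fun b j => b (i.succAbove j)) ?_ ?_
  · intro b hb
    obtain ⟨v, rfl, rfl⟩ := (mem_sumset_iff A).1 hb
    simp only [Finset.mem_coe, Fintype.mem_piFinset, Finset.mem_range]
    exact fun j => Nat.lt_succ_of_le (weightedSum_apply_le A v _)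
  · intro b hb b' hb' hbb
    obtain ⟨v, hv, rfl⟩ := (mem_sumset_iff A).1 hb
    obtain ⟨v', hv', rfl⟩ := (mem_sumset_iff A).1 hb'
    have h1 := sum_mul_weightedSum A h v
    have h2 := sum_mul_weightedSum A h v'
    rw [hv, Fin.sum_univ_succAbove _ i] at h1
    rw [hv', Fin.sum_univ_succAbove _ i] at h2
    have h3 : ∀ j, weightedSum A v (i.succAbove j) = weightedSum A v' (i.succAbove j) :=
      fun j => congr_fun hbb j
    simp only [h3] at h1
    have h4 : w i * (weightedSum A v i : ℚ) = w i * (weightedSum A v' i : ℚ) := by linarith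
    have h5 := mul_left_cancel₀ hi h4
    ext j
    rcases Fin.eq_self_or_eq_succAbove i j with rfl | ⟨k, rfl⟩
    · exact_mod_cast h5
    · exact h3 k

theorem not_forall_choose_div_le {M D m : ℕ} (hM : 1 ≤ M) :
    ¬ ∀ t : ℕ, (t / M).choose (m + 1) ≤ (t * D + 1) ^ m := by
  intro h
  -- At `t = (x + m) * M` the left side is at least `x ^ (m + 1) / (m + 1)!` and the right side at
  -- most `(C * x) ^ m`. This forces `x ≤ (m + 1)! * C ^ m`, and `x` is taken one larger.
  set C := (m + 1) * M * D + 1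
  set x := (m + 1).factorial * C ^ m + 1
  have h1 := h ((x + m) * M)
  rw [Nat.mul_div_cancel _ hM] at h1
  have h2 : (x + m) * M * D + 1 ≤ C * x := by
    have hx : x + m ≤ (m + 1) * x := by
      have : 1 ≤ x := Nat.le_add_left _ _
      nlinarith
    have := Nat.mul_le_mul_right (M * D) hx
    have hx1 : 1 ≤ x := Nat.le_add_left _ _
    simp only [C]
    nlinarith
  have h3 := h1.trans (Nat.pow_le_pow_left h2 m)
  have h4 := Nat.pow_le_choose (α := ℚ) (m + 1) (x + m)
  rw [div_le_iff₀ (by positivity)] at h4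
  have h5 : x + m + 1 - (m + 1) = x := by omega
  rw [h5] at h4
  have h6 : x ^ (m + 1) ≤ (C * x) ^ m * (m + 1).factorial := by
    have : x ^ (m + 1) ≤ (x + m).choose (m + 1) * (m + 1).factorial := by exact_mod_cast h4
    exact this.trans (Nat.mul_le_mul_right _ h3)
  have h7 : x ≤ C ^ m * (m + 1).factorial := by
    refine Nat.le_of_mul_le_mul_left (c := x ^ m) ?_ (by positivity)
    calc x ^ m * x = x ^ (m + 1) := (pow_succ x m).symm
      _ ≤ (C * x) ^ m * (m + 1).factorial := h6
      _ = x ^ m * (C ^ m * (m + 1).factorial) := by rw [mul_pow, mul_comm (C ^ m), mul_assoc]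
  have : x = C ^ m * (m + 1).factorial + 1 := by simp only [x, mul_comm]
  omega

/-- `A` is not contained in a proper affine subspace of `ℚⁿ`. -/
def AffinelySpans : Prop :=
  ∀ (w : Fin n → ℚ) (c : ℚ), (∀ a ∈ A, ∑ i, w i * (a i : ℚ) = c) → w = 0

theorem affinelySpans_of_topologicalKrullDim (K : Type*) [Field K] [Infinite K] (hn : 1 ≤ n)
    (hA : A.Nonempty) (hdim : (n : WithBot ℕ∞) ≤ topologicalKrullDim (monomialVariety K A)) :
    AffinelySpans A := by
  intro w c h
  by_contra hw
  obtain ⟨M, hM, hH⟩ := exists_choose_div_le_hilbertFun isClosed_closure hdim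
  obtain ⟨m, rfl⟩ := Nat.exists_eq_add_of_le' hn
  refine not_forall_choose_div_le (D := maxDegree A) hM fun t => (hH t).trans ?_
  change hilbertFun (monomialVariety K A) t ≤ _
  rw [hilbertFun_monomialVariety A K hA]
  exact cardFun_le_of_functional A h hw t

/-- An affine relation between the elements of `A`. -/
def IsRelation {R : Type*} [CommRing R] (c : A → R) : Prop :=
  ∑ a, c a = 0 ∧ ∀ i, ∑ a : A, c a * (a.1 i : R) = 0

/-- The matrix whose columns are the vectors `(1, a)` with `a ∈ A`. -/
def homMatrix : Matrix (Fin (n + 1)) A ℚ :=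
  fun i a => (Fin.cons 1 fun j => (a.1 j : ℚ) : Fin (n + 1) → ℚ) i

variable {A}

theorem mem_ker_homMatrix_iff {c : A → ℚ} :
    c ∈ LinearMap.ker (homMatrix A).mulVecLin ↔ IsRelation A c := by
  rw [LinearMap.mem_ker, Matrix.mulVecLin_apply, funext_iff, Fin.forall_fin_succ]
  simp [homMatrix, Matrix.mulVec, dotProduct, IsRelation, mul_comm]

/-- A vector killed by the transpose is an affine function vanishing on `A`, hence zero. The matrix
therefore has full row rank `n + 1`. -/
theorem AffinelySpans.finrank_ker (hA : A.Nonempty) (h : AffinelySpans A) :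
    Module.finrank ℚ (LinearMap.ker (homMatrix A).mulVecLin) + (n + 1) = A.card := by
  have hinj : Function.Injective (homMatrix A).transpose.mulVecLin := by
    rw [← LinearMap.ker_eq_bot, LinearMap.ker_eq_bot']
    intro w hw
    have hw' : ∀ a ∈ A, ∑ i : Fin n, w i.succ * (a i : ℚ) = - w 0 := by
      intro a ha
      have := congr_fun hw ⟨a, ha⟩
      simp only [homMatrix, Matrix.mulVecLin_apply, Matrix.mulVec, dotProduct,
        Matrix.transpose_apply, Fin.sum_univ_succ, Fin.cons_zero, Fin.cons_succ, one_mul,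
        Pi.zero_apply] at this
      simp only [mul_comm (w _)]
      linarith
    have h0 := h _ _ hw'
    have h1 : ∀ i : Fin n, w i.succ = 0 := fun i => congr_fun h0 i
    obtain ⟨a, ha⟩ := hA
    have h2 := hw' a ha
    simp only [h1, zero_mul, Finset.sum_const_zero] at h2
    ext i
    refine Fin.cases ?_ h1 i
    simpa using h2.symm
  have hrank : (homMatrix A).rank = n + 1 := by
    rw [← Matrix.rank_transpose, Matrix.rank, LinearMap.finrank_range_of_inj hinj]
    simp
  have := LinearMap.finrank_range_add_finrank_ker (homMatrix A).mulVecLin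
  rw [← Matrix.rank, hrank] at this
  simp only [Module.finrank_fintype_fun_eq_card, Fintype.card_coe] at this
  omega

theorem IsRelation.intCast {c : A → ℤ} (hc : IsRelation A c) :
    IsRelation A fun a => (c a : ℚ) := by
  obtain ⟨h1, h2⟩ := hc
  refine ⟨?_, fun i => ?_⟩
  · rw [← Int.cast_sum, h1, Int.cast_zero]
  · have := congr_arg (Int.cast (R := ℚ)) (h2 i)
    push_cast at this
    exact this

theorem weightedSum_apply (v : A →₀ ℕ) (i : Fin n) :
    weightedSum A v i = ∑ a : A, v a * a.1 i := by
  rw [weightedSum, Finsupp.linearCombination_apply, Finsupp.sum_fintype _ _ (by simp)]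
  simp

theorem isRelation_sub_iff {v w : A →₀ ℕ} :
    IsRelation A (fun a => (v a : ℤ) - (w a : ℤ)) ↔
      v.degree = w.degree ∧ weightedSum A v = weightedSum A w := by
  simp only [IsRelation, Finset.sum_sub_distrib, sub_mul, sub_eq_zero, Finsupp.degree_eq_sum,
    funext_iff, weightedSum_apply]
  norm_cast

theorem AffinelySpans.eq_zero_of_isRelation (h : AffinelySpans A) (hcard : A.card = n + 1)
    {c : A → ℚ} (hc : IsRelation A c) : c = 0 := by
  have hA : A.Nonempty := Finset.card_pos.1 (by omega)
  have hk := h.finrank_ker hA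
  have : LinearMap.ker (homMatrix A).mulVecLin = ⊥ :=
    Submodule.finrank_eq_zero.1 (by omega)
  have hm := mem_ker_homMatrix_iff.2 hc
  rwa [this, Submodule.mem_bot] at hm

theorem exists_primitive_multiple {κ : Type*} [Fintype κ] {c : κ → ℚ} (hc : c ≠ 0) :
    ∃ (u : κ → ℤ) (r : ℚ), r ≠ 0 ∧ (∀ a, (u a : ℚ) = r * c a) ∧ Finset.univ.gcd u = 1 := by
  obtain ⟨a₀, ha₀⟩ := Function.ne_iff.1 hc
  set N : ℕ := ∏ a, (c a).den
  have hN : (N : ℚ) ≠ 0 := by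
    simp [N, Finset.prod_ne_zero_iff]
  have hint : ∀ a, ∃ z : ℤ, (z : ℚ) = N * c a := by
    intro a
    obtain ⟨k, hk⟩ : (c a).den ∣ N := Finset.dvd_prod_of_mem _ (Finset.mem_univ a)
    refine ⟨k * (c a).num, ?_⟩
    rw [hk]
    push_cast
    rw [mul_right_comm, Rat.den_mul_eq_num, mul_comm]
  choose z hz using hint
  obtain ⟨u, hu, hgcd⟩ := Finset.extract_gcd z (s := Finset.univ) ⟨a₀, Finset.mem_univ _⟩
  have hg : ((Finset.univ.gcd z : ℤ) : ℚ) ≠ 0 := by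
    intro h0
    have := Finset.gcd_eq_zero_iff.1 (by exact_mod_cast h0) a₀ (Finset.mem_univ _)
    have h1 := hz a₀
    rw [this] at h1
    simp [hN] at h1
    exact ha₀ h1
  refine ⟨u, N / (Finset.univ.gcd z : ℤ), div_ne_zero hN hg, fun a => ?_, hgcd⟩
  have h1 := hz a
  rw [hu a (Finset.mem_univ a)] at h1
  push_cast at h1
  field_simp
  rw [← h1]
  exact mul_comm _ _

/-- The denominator of `q` is prime to its numerator, so it divides every `u a`, hence their gcd. -/
theorem exists_int_of_gcd_eq_one {κ : Type*} [Fintype κ] {u w : κ → ℤ} {q : ℚ}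
    (hu : Finset.univ.gcd u = 1) (h : ∀ a, (w a : ℚ) = q * u a) : ∃ k : ℤ, ∀ a, w a = k * u a := by
  have hdvd : (q.den : ℤ) ∣ Finset.univ.gcd u := by
    refine Finset.dvd_gcd fun a _ => ?_
    have h1 : (q.den : ℤ) * w a = q.num * u a := by
      have : (q.den : ℚ) * w a = q.num * u a := by
        rw [h a, ← mul_assoc, Rat.den_mul_eq_num]
      exact_mod_cast this
    refine IsCoprime.dvd_of_dvd_mul_left (y := q.num) ?_ ⟨w a, h1.symm⟩
    exact (Int.isCoprime_iff_nat_coprime.2 (by simpa using q.reduced)).symm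
  rw [hu] at hdvd
  have hden : q.den = 1 := by
    have := Int.natAbs_dvd_natAbs.2 hdvd
    simpa using this
  refine ⟨q.num, fun a => ?_⟩
  have := h a
  rw [← Rat.coe_int_num_of_den_eq_one hden] at this
  exact_mod_cast this

/-- The rational relations form a line. A primitive integral vector on it generates all its integral
points. -/
theorem AffinelySpans.exists_primitive_relation (h : AffinelySpans A) (hcard : A.card = n + 2) :
    ∃ u : A → ℤ, u ≠ 0 ∧ IsRelation A u ∧
      ∀ w : A → ℤ, IsRelation A w → ∃ k : ℤ, ∀ a, w a = k * u a := by
  have hA : A.Nonempty := Finset.card_pos.1 (by omega)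
  have hk := h.finrank_ker hA
  have hk1 : Module.finrank ℚ (LinearMap.ker (homMatrix A).mulVecLin) = 1 := by omega
  obtain ⟨⟨c, hcker⟩, hc0, hc⟩ := finrank_eq_one_iff'.1 hk1
  have hc0' : c ≠ 0 := fun h0 => hc0 (Subtype.ext h0)
  have hcrel := mem_ker_homMatrix_iff.1 hcker
  obtain ⟨u, r, hr, hu, hgcd⟩ := exists_primitive_multiple hc0'
  refine ⟨u, ?_, ?_, ?_⟩
  · rintro rfl
    refine hc0' (funext fun a => ?_)
    have := hu a
    simpa [hr] using this.symm
  · refine ⟨?_, fun i => ?_⟩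
    · have : ∑ a, (u a : ℚ) = 0 := by
        simp only [hu, ← Finset.mul_sum, hcrel.1, mul_zero]
      exact_mod_cast this
    · have : ∑ a : A, (u a : ℚ) * (a.1 i : ℚ) = 0 := by
        simp only [hu, mul_assoc, ← Finset.mul_sum, hcrel.2 i, mul_zero]
      exact_mod_cast this
  · intro w hw
    obtain ⟨s, hs⟩ := hc ⟨_, mem_ker_homMatrix_iff.2 hw.intCast⟩
    refine exists_int_of_gcd_eq_one (q := s / r) hgcd fun a => ?_
    have h1 := congr_fun (congr_arg Subtype.val hs) a
    simp only [SetLike.mk_smul_mk, Pi.smul_apply, smul_eq_mul] at h1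
    rw [hu a, ← h1]
    field_simp

end Relations

/-! ### Lattices of relations of rank one -/

section Binomial

variable {κ τ : Type*}

/-- The fibres of the monomial map with exponents `e` are generated by the single move which
replaces `p` by `q`. -/
structure IsGeneratingMove (e : κ → τ →₀ ℕ) (p q : κ →₀ ℕ) : Prop where
  ne_zero : p ≠ 0
  disjoint : ∀ a, p a = 0 ∨ q a = 0
  map_eq : Finsupp.linearCombination ℕ e p = Finsupp.linearCombination ℕ e q
  exists_move : ∀ v w : κ →₀ ℕ, Finsupp.linearCombination ℕ e v = Finsupp.linearCombination ℕ e w →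
    ∃ (r : κ →₀ ℕ) (k : ℕ), (v = r + k • p ∧ w = r + k • q) ∨ (v = r + k • q ∧ w = r + k • p)

namespace IsGeneratingMove

variable {e : κ → τ →₀ ℕ} {p q : κ →₀ ℕ}

theorem ne (h : IsGeneratingMove e p q) : p ≠ q := by
  rintro rfl
  refine h.ne_zero (Finsupp.ext fun a => ?_)
  simpa using h.disjoint a

/-- Two exponents in one fibre differ by `k` moves, and for `k > 0` one of them is at least `p`. -/
theorem injOn_normal (h : IsGeneratingMove e p q) :
    Set.InjOn (Finsupp.linearCombination ℕ e) {v | ¬ p ≤ v} := by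
  have aux : ∀ (r : κ →₀ ℕ) (k : ℕ), ¬ p ≤ r + k • p → k = 0 := by
    intro r k hk
    by_contra hk0
    refine hk fun a => ?_
    have : p a ≤ k * p a := Nat.le_mul_of_pos_left _ (Nat.pos_of_ne_zero hk0)
    simp only [Finsupp.add_apply, Finsupp.smul_apply, smul_eq_mul]
    omega
  intro v hv w hw hvw
  obtain ⟨r, k, ⟨rfl, rfl⟩ | ⟨rfl, rfl⟩⟩ := h.exists_move v w hvw
  · obtain rfl := aux r k hv
    simp
  · obtain rfl := aux r k hw
    simp

theorem exists_normal (h : IsGeneratingMove e p q) (v : κ →₀ ℕ) :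
    ∃ (r : κ →₀ ℕ) (k : ℕ), v = r + k • p ∧ ¬ p ≤ r + k • q := by
  classical
  -- The number of copies of `p` that fit into `v` is at most `v.degree` because `p ≠ 0`. If `p`
  -- still fitted after trading the maximal number for copies of `q`, disjointness of supports would
  -- let one more copy fit into `v`.
  set k := Nat.findGreatest (fun k => k • p ≤ v) v.degree
  have hk : k • p ≤ v := Nat.findGreatest_spec (P := fun k => k • p ≤ v) (Nat.zero_le _) (by simp)
  refine ⟨v - k • p, k, (tsub_add_cancel_of_le hk).symm, fun hle => ?_⟩
  have hk1 : (k + 1) • p ≤ v := by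
    intro a
    have h1 := hle a
    have h2 := hk a
    simp only [Finsupp.add_apply, Finsupp.smul_apply, smul_eq_mul, Finsupp.tsub_apply] at h1 h2 ⊢
    rw [add_mul, one_mul]
    rcases h.disjoint a with h0 | h0
    · simp [h0]
    · rw [h0, mul_zero] at h1
      omega
  have hbound : k + 1 ≤ v.degree := by
    obtain ⟨a, ha⟩ := Finsupp.ne_iff.1 h.ne_zero
    have h1 := hk1 a
    simp only [Finsupp.smul_apply, smul_eq_mul] at h1
    have h2 : k + 1 ≤ (k + 1) * p a := Nat.le_mul_of_pos_right _ (Nat.pos_of_ne_zero ha)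
    exact (h2.trans h1).trans (Finsupp.le_degree a v)
  exact absurd (Nat.le_findGreatest (P := fun k => k • p ≤ v) hbound hk1) (by simp [k])

theorem map_add_smul_eq (h : IsGeneratingMove e p q) (r : κ →₀ ℕ) (k : ℕ) :
    Finsupp.linearCombination ℕ e (r + k • p) =
    Finsupp.linearCombination ℕ e (r + k • q) := by
  simp only [map_add, map_nsmul, h.map_eq]

variable (K : Type*) [Field K]

theorem toricMap_binomial (h : IsGeneratingMove e p q) :
    toricMap K e (MvPolynomial.monomial p 1 - MvPolynomial.monomial q 1) = 0 := by
  rw [map_sub, toricMap_monomial, toricMap_monomial, h.map_eq, sub_self]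

/-- Modulo the binomial every polynomial reduces to a combination `N f` of monomials not divisible
by `x^p`. These have distinct images, so `N f` vanishes when `f` lies in the kernel. -/
theorem ker_toricMap (h : IsGeneratingMove e p q) : RingHom.ker (toricMap K e) =
    Ideal.span {MvPolynomial.monomial p 1 - MvPolynomial.monomial q 1} := by
  classical
  set F : MvPolynomial κ K := MvPolynomial.monomial p 1 - MvPolynomial.monomial q 1
  refine le_antisymm (fun f hf => ?_) ?_
  · choose r k hv hnormal using h.exists_normal
    let N : MvPolynomial κ K → MvPolynomial κ K := fun f =>
      ∑ v ∈ f.support, MvPolynomial.monomial (r v + k v • q) (f.coeff v)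
    have hmem : f - N f ∈ Ideal.span {F} := by
      nth_rewrite 1 [f.as_sum]
      rw [← Finset.sum_sub_distrib]
      refine Ideal.sum_mem _ fun v _ => Ideal.mem_span_singleton.2 ?_
      have hdvd : F ∣ MvPolynomial.monomial p (1 : K) ^ k v - MvPolynomial.monomial q 1 ^ k v :=
        sub_dvd_pow_sub_pow _ _ _
      have heq : MvPolynomial.monomial v (f.coeff v) -
          MvPolynomial.monomial (r v + k v • q) (f.coeff v) =
          MvPolynomial.monomial (r v) (f.coeff v) *
            (MvPolynomial.monomial p (1 : K) ^ k v - MvPolynomial.monomial q 1 ^ k v) := by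
        nth_rewrite 1 [hv v]
        simp [mul_sub, MvPolynomial.monomial_pow, MvPolynomial.monomial_mul]
      rw [heq]
      exact hdvd.mul_left _
    have hFker : Ideal.span {F} ≤ RingHom.ker (toricMap K e) :=
      (Ideal.span_singleton_le_iff_mem _).2 (h.toricMap_binomial K)
    have hN0 : toricMap K e (N f) = 0 := by
      have := hFker hmem
      rwa [RingHom.mem_ker, map_sub, (RingHom.mem_ker).1 hf, zero_sub, neg_eq_zero] at this
    have hsupp : ∀ v ∈ (N f).support, ¬ p ≤ v := by
      intro v hvN
      obtain ⟨w, hw, hvw⟩ := Finset.mem_biUnion.1 (MvPolynomial.support_sum hvN)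
      obtain rfl := Finset.mem_singleton.1 (MvPolynomial.support_monomial_subset hvw)
      exact hnormal w
    have hNf : N f = 0 := by
      by_contra hne
      obtain ⟨m, hm⟩ := MvPolynomial.support_nonempty.2 hne
      have h1 := congr_arg (MvPolynomial.coeff (Finsupp.linearCombination ℕ e m)) hN0
      rw [(N f).as_sum, map_sum, MvPolynomial.coeff_sum,
        Finset.sum_eq_single_of_mem m hm] at h1
      · rw [toricMap_monomial, MvPolynomial.coeff_monomial, if_pos rfl, MvPolynomial.coeff_zero]
          at h1
        exact (MvPolynomial.mem_support_iff.1 hm) h1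
      · intro v hv hvm
        rw [toricMap_monomial, MvPolynomial.coeff_monomial, if_neg]
        exact fun heq => hvm (h.injOn_normal (hsupp v hv) (hsupp m hm) heq)
    rwa [hNf, sub_zero] at hmem
  · exact (Ideal.span_singleton_le_iff_mem _).2 (h.toricMap_binomial K)

theorem irreducible_binomial (h : IsGeneratingMove e p q) :
    Irreducible (MvPolynomial.monomial p 1 - MvPolynomial.monomial q 1 : MvPolynomial κ K) := by
  refine Prime.irreducible ?_
  have hne : (MvPolynomial.monomial p 1 - MvPolynomial.monomial q 1 : MvPolynomial κ K) ≠ 0 := by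
    rw [sub_ne_zero]
    exact fun heq => h.ne (MvPolynomial.monomial_left_injective one_ne_zero heq)
  rw [← Ideal.span_singleton_prime hne, ← h.ker_toricMap K]
  exact RingHom.ker_isPrime _

end IsGeneratingMove

end Binomial

/-! ### Counting normal monomials -/

section Counting

theorem card_degree_eq {κ : Type*} [Fintype κ] {n : ℕ} (hκ : Fintype.card κ = n + 1) (t : ℕ) :
    {v : κ →₀ ℕ | v.degree = t}.ncard = (t + n).choose n := by
  classical
  have : {v : κ →₀ ℕ | v.degree = t} = ((Finset.univ : Finset κ).finsuppAntidiag t : Set _) := by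
    ext v
    simp [Finset.mem_finsuppAntidiag, Finsupp.degree_eq_sum]
  rw [this, Set.ncard_coe_finset, Finset.card_finsuppAntidiag_nat_eq_choose, Finset.card_univ, hκ,
    show n + 1 + t - 1 = t + n by omega, Nat.choose_symm_add]

theorem finite_degree_eq {κ : Type*} [Finite κ] (t : ℕ) : {v : κ →₀ ℕ | v.degree = t}.Finite := by
  classical
  cases nonempty_fintype κ
  have : {v : κ →₀ ℕ | v.degree = t} = ((Finset.univ : Finset κ).finsuppAntidiag t : Set _) := by
    ext v
    simp [Finset.mem_finsuppAntidiag, Finsupp.degree_eq_sum]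
  rw [this]
  exact Finset.finite_toSet _

theorem ncard_degree_le {κ : Type*} [Finite κ] (p : κ →₀ ℕ) (t : ℕ) :
    {v : κ →₀ ℕ | v.degree = t + p.degree ∧ p ≤ v}.ncard = {v : κ →₀ ℕ | v.degree = t}.ncard := by
  rw [← Set.ncard_image_of_injective {v : κ →₀ ℕ | v.degree = t} (add_left_injective p)]
  congr 1
  ext v
  constructor
  · rintro ⟨hv, hle⟩
    obtain ⟨w, rfl⟩ := exists_add_of_le hle
    refine ⟨w, ?_, add_comm _ _⟩
    rw [map_add] at hv
    simp only [Set.mem_ofPred_eq]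
    omega
  · rintro ⟨w, rfl, rfl⟩
    exact ⟨by simp, le_add_self⟩

variable {n : ℕ} {A : Finset (Fin n → ℕ)}

theorem cardFun_of_injective (hcard : A.card = n + 1)
    (h : ∀ v w : A →₀ ℕ, v.degree = w.degree → weightedSum A v = weightedSum A w → v = w) (t : ℕ) :
    cardFun A t = (t + n).choose n := by
  rw [cardFun, ← Set.ncard_coe_finset, coe_sumset, Set.InjOn.ncard_image,
    card_degree_eq (by simpa using hcard)]
  exact fun v hv w hw => h v w (hv.trans hw.symm)

/-- Each fibre has exactly one normal representative, and moves preserve the degree because `p` and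
`q` have the same degree. -/
theorem cardFun_eq_ncard_normal {p q : A →₀ ℕ} (h : IsGeneratingMove (homExponent A) p q)
    (hdeg : p.degree = q.degree) (t : ℕ) :
    cardFun A t = {v : A →₀ ℕ | v.degree = t ∧ ¬ p ≤ v}.ncard := by
  have himage : Finsupp.linearCombination ℕ (homExponent A) '' {v | v.degree = t} =
      Finsupp.linearCombination ℕ (homExponent A) '' {v | v.degree = t ∧ ¬ p ≤ v} := by
    refine le_antisymm ?_ (Set.image_mono fun v hv => hv.1)
    rintro _ ⟨v, hv, rfl⟩
    obtain ⟨r, k, rfl, hnormal⟩ := h.exists_normal v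
    refine ⟨r + k • q, ⟨?_, hnormal⟩, (h.map_add_smul_eq r k).symm⟩
    simpa [hdeg] using hv
  rw [← ncard_image_homExponent, himage, Set.InjOn.ncard_image]
  exact h.injOn_normal.mono fun v hv => hv.2

/-- The monomials of degree `t + p.degree` are either normal or `x^p` times a monomial of degree
`t`. -/
theorem cardFun_add_of_le {p q : A →₀ ℕ} (h : IsGeneratingMove (homExponent A) p q)
    (hdeg : p.degree = q.degree) (hcard : A.card = n + 2) (t : ℕ) :
    cardFun A (t + p.degree) + (t + (n + 1)).choose (n + 1) =
      (t + p.degree + (n + 1)).choose (n + 1) := by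
  have hκ : Fintype.card A = (n + 1) + 1 := by simpa using hcard
  rw [cardFun_eq_ncard_normal h hdeg, ← card_degree_eq hκ t, ← ncard_degree_le p,
    ← card_degree_eq hκ, ← Set.ncard_union_eq ?_ ?_ ?_]
  · congr 1
    ext v
    simp only [Set.mem_union, Set.mem_ofPred_eq]
    tauto
  · exact Set.disjoint_left.2 fun v hv hv' => hv.2 hv'.2
  · exact (finite_degree_eq _).subset fun v hv => hv.1
  · exact (finite_degree_eq _).subset fun v hv => hv.1

theorem cardFun_of_lt {p q : A →₀ ℕ} (h : IsGeneratingMove (homExponent A) p q)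
    (hdeg : p.degree = q.degree) (hcard : A.card = n + 2) {t : ℕ} (ht : t < p.degree) :
    cardFun A t = (t + (n + 1)).choose (n + 1) := by
  have hκ : Fintype.card A = (n + 1) + 1 := by simpa using hcard
  rw [cardFun_eq_ncard_normal h hdeg, ← card_degree_eq hκ]
  congr 1
  ext v
  simp only [Set.mem_ofPred_eq, and_iff_left_iff_imp]
  rintro rfl hle
  exact absurd (Finsupp.degree_mono hle) (by omega)

end Counting

/-! ### From a primitive relation to a binomial hypersurface -/

section Existence

variable {n : ℕ} {A : Finset (Fin n → ℕ)}

theorem maxDegree_ne_zero (hA : 2 ≤ A.card) : maxDegree A ≠ 0 := by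
  intro h0
  have : A ⊆ {0} := by
    intro a ha
    have h1 : ∑ i, a i ≤ maxDegree A := Finset.le_sup (f := fun a => ∑ i, a i) ha
    rw [h0, Nat.le_zero, Finset.sum_eq_zero_iff] at h1
    exact Finset.mem_singleton.2 (funext fun i => h1 i (Finset.mem_univ i))
  have := Finset.card_le_card this
  simp at this
  omega

theorem exists_isGeneratingMove (hA : 2 ≤ A.card) {u : A → ℤ} (hu0 : u ≠ 0)
    (hu : IsRelation A u) (hgen : ∀ w : A → ℤ, IsRelation A w → ∃ k : ℤ, ∀ a, w a = k * u a) :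
    ∃ p q : A →₀ ℕ, IsGeneratingMove (homExponent A) p q ∧ p.degree = q.degree := by
  -- The move consists of the positive and negative parts of `u`.
  set p : A →₀ ℕ := Finsupp.equivFunOnFinite.symm fun a => (u a).toNat
  set q : A →₀ ℕ := Finsupp.equivFunOnFinite.symm fun a => (-u a).toNat
  have hp : ∀ a, p a = (u a).toNat := fun a => rfl
  have hq : ∀ a, q a = (-u a).toNat := fun a => rfl
  have hpq : ∀ a, (p a : ℤ) - q a = u a := fun a => by rw [hp, hq]; omega
  have hrel : IsRelation A (fun a => (p a : ℤ) - (q a : ℤ)) := by simpa only [hpq] using hu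
  obtain ⟨hdeg, hsum⟩ := isRelation_sub_iff.1 hrel
  have hdisj : ∀ a, p a = 0 ∨ q a = 0 := fun a => by rw [hp, hq]; omega
  refine ⟨p, q, ⟨?_, hdisj, linearCombination_homExponent_eq_of_degree_eq A hdeg hsum, ?_⟩, hdeg⟩
  · intro hp0
    have hq0 : q = 0 := by
      rw [hp0, map_zero] at hdeg
      exact (Finsupp.degree_eq_zero_iff _).1 hdeg.symm
    refine hu0 (funext fun a => ?_)
    rw [← hpq a, hp0, hq0]
    rfl
  · have aux : ∀ (v w : A →₀ ℕ) (k : ℕ), (∀ a, (v a : ℤ) - w a = k * u a) →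
        ∃ r : A →₀ ℕ, v = r + k • p ∧ w = r + k • q := by
      intro v w k hk
      have hle : k • p ≤ v := by
        intro a
        have h1 := hk a
        rw [← hpq a] at h1
        simp only [Finsupp.smul_apply, smul_eq_mul]
        rcases hdisj a with h0 | h0
        · simp [h0]
        · rw [h0] at h1
          zify
          push_cast at h1
          linarith [Int.natCast_nonneg (w a)]
      refine ⟨v - k • p, (tsub_add_cancel_of_le hle).symm, ?_⟩
      ext a
      have h1 := hk a
      have h2 := hle a
      rw [← hpq a] at h1
      simp only [Finsupp.add_apply, Finsupp.smul_apply, smul_eq_mul, Finsupp.tsub_apply] at h2 ⊢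
      zify [h2]
      linarith
    intro v w hvw
    obtain ⟨k, hk⟩ := hgen _ (isRelation_sub_iff.2
      ⟨degree_eq_of_linearCombination_eq A (maxDegree_ne_zero hA) hvw,
        weightedSum_eq_of_linearCombination_eq A hvw⟩)
    -- The sign of the multiple of `u` decides the direction of the move.
    obtain ⟨k, rfl | rfl⟩ := k.eq_nat_or_neg
    · obtain ⟨r, hr⟩ := aux v w k hk
      exact ⟨r, k, Or.inl hr⟩
    · obtain ⟨r, hr⟩ := aux w v k fun a => by linarith [hk a]
      exact ⟨r, k, Or.inr hr.symm⟩

theorem isHypersurface_monomialVariety (K : Type*) [Field K] [Infinite K] (hA : A.Nonempty)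
    {p q : A →₀ ℕ} (h : IsGeneratingMove (homExponent A) p q) (hdeg : p.degree = q.degree) :
    IsHypersurface (monomialVariety K A) p.degree := by
  have hhom : (MvPolynomial.monomial p 1 - MvPolynomial.monomial q 1 :
      MvPolynomial A K).IsHomogeneous p.degree :=
    (MvPolynomial.isHomogeneous_monomial _ rfl).sub
      (MvPolynomial.isHomogeneous_monomial _ hdeg.symm)
  refine ⟨isClosed_closure, _, hhom, h.irreducible_binomial K, le_antisymm ?_ ?_⟩
  · refine Ideal.span_le.2 fun g hg => ?_
    obtain ⟨⟨m, hm⟩, hvan⟩ := hg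
    rw [← h.ker_toricMap K]
    exact (vanishes_on_monomialVariety_iff A K hA hm).1 hvan
  · refine (Ideal.span_singleton_le_iff_mem _).2 ((mem_homIdeal_iff hhom).2 ?_)
    exact (vanishes_on_monomialVariety_iff A K hA hhom).2 (h.toricMap_binomial K)

end Existence

/-! ### Hilbert polynomials of hypersurfaces -/

section HilbertPolynomials

/-- For `k - d ≤ t < k` both sides vanish, as these are the `d` roots of the polynomial. This is why
the formula for large `t` is already valid below the degree of the hypersurface. -/
theorem eval_preHilbertPoly_of_le {d k t : ℕ} (h : k ≤ t + d) :
    (preHilbertPoly ℚ d k).eval (t : ℚ) = ((t + d - k).choose d : ℚ) := by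
  rcases le_or_gt k t with hk | hk
  · rw [preHilbertPoly_eq_choose_sub_add ℚ d hk, Nat.sub_add_comm hk]
  · have h1 : (t : ℚ) - k + 1 = -((k - 1 - t : ℕ) : ℚ) := by
      rw [Nat.cast_sub (by omega), Nat.cast_sub (by omega)]
      push_cast
      ring
    rw [Nat.choose_eq_zero_of_lt (by omega)]
    simp only [preHilbertPoly, eval_smul, eval_comp, eval_add, eval_sub, eval_X, eval_C, eval_one]
    rw [h1, ascPochhammer_eval_neg_coe_nat_of_lt (by omega)]
    simp

/-- Just below the run of roots the value is `(-1) ^ d`; this makes the phase transition sharp. -/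
theorem eval_preHilbertPoly_ne_zero (d t : ℕ) :
    (preHilbertPoly ℚ d (t + d + 1)).eval (t : ℚ) ≠ 0 := by
  have h1 : (t : ℚ) - (t + d + 1 : ℕ) + 1 = -(d : ℚ) := by
    push_cast
    ring
  simp only [preHilbertPoly, eval_smul, eval_comp, eval_add, eval_sub, eval_X, eval_C, eval_one]
  rw [h1, ascPochhammer_eval_neg_eq_descPochhammer, descPochhammer_eval_eq_descFactorial,
    Nat.descFactorial_self]
  simp [Nat.factorial_ne_zero]

theorem preHilbertPoly_sub_succ (n k : ℕ) :
    preHilbertPoly ℚ (n + 1) k - preHilbertPoly ℚ (n + 1) (k + 1) = preHilbertPoly ℚ n k := by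
  refine Polynomial.eq_of_infinite_eval_eq _ _ (Set.Infinite.mono ?_
    ((Set.Ici_infinite (k + 1)).image (f := fun t : ℕ => (t : ℚ)) Nat.cast_injective.injOn))
  rintro _ ⟨t, ht, rfl⟩
  obtain ⟨s, rfl⟩ := Nat.exists_eq_add_of_le ht
  simp only [Set.mem_ofPred_eq, eval_sub]
  rw [eval_preHilbertPoly_of_le (by omega), eval_preHilbertPoly_of_le (by omega),
    eval_preHilbertPoly_of_le (by omega), show k + 1 + s + (n + 1) - k = (s + n + 1) + 1 by omega,
    show k + 1 + s + (n + 1) - (k + 1) = s + n + 1 by omega,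
    show k + 1 + s + n - k = s + n + 1 by omega, Nat.choose_succ_succ']
  push_cast
  ring

theorem preHilbertPoly_zero_sub (n d : ℕ) :
    preHilbertPoly ℚ (n + 1) 0 - preHilbertPoly ℚ (n + 1) d =
      ∑ j ∈ Finset.range d, preHilbertPoly ℚ n j := by
  induction d with
  | zero => simp
  | succ d ih => rw [Finset.sum_range_succ, ← ih, ← preHilbertPoly_sub_succ n d, sub_add_sub_cancel]

theorem coeff_sum_preHilbertPoly (n d : ℕ) :
    (∑ j ∈ Finset.range d, preHilbertPoly ℚ n j).coeff n = d / n.factorial := by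
  simp [Polynomial.finsetSum_coeff, coeff_preHilbertPoly_self, div_eq_mul_inv]

theorem natDegree_sum_preHilbertPoly {n d : ℕ} (hd : d ≠ 0) :
    (∑ j ∈ Finset.range d, preHilbertPoly ℚ n j).natDegree = n := by
  refine natDegree_eq_of_le_of_coeff_ne_zero
    (natDegree_sum_le_of_forall_le _ _ fun j _ => (natDegree_preHilbertPoly ℚ n j).le) ?_
  rw [coeff_sum_preHilbertPoly]
  exact div_ne_zero (by exact_mod_cast hd) (by exact_mod_cast n.factorial_ne_zero)

variable {n : ℕ} {A : Finset (Fin n → ℕ)}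

theorem sumsetPoly_eq_of_choose (h : ∀ t, cardFun A t = (t + n).choose n) :
    sumsetPoly A = preHilbertPoly ℚ n 0 := by
  refine eventualPoly_eq (Filter.Eventually.of_forall fun t => ?_)
  rw [h, eval_preHilbertPoly_of_le (Nat.zero_le _), Nat.sub_zero]

theorem phaseTransition_eq_zero (h : ∀ t : ℕ, (cardFun A t : ℚ) = (sumsetPoly A).eval (t : ℚ)) :
    phaseTransition A = 0 :=
  Nat.sInf_eq_zero.2 (Or.inl fun t _ => h t)

variable {d : ℕ}

theorem sumsetPoly_eq_sub
    (h : ∀ t, d ≤ t + n + 1 → (cardFun A t : ℤ) =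
      ((t + n + 1).choose (n + 1) : ℤ) - ((t + n + 1 - d).choose (n + 1) : ℤ)) :
    (∀ t : ℕ, d ≤ t + n + 1 → (cardFun A t : ℚ) =
      (preHilbertPoly ℚ (n + 1) 0 - preHilbertPoly ℚ (n + 1) d).eval (t : ℚ)) ∧
    sumsetPoly A = preHilbertPoly ℚ (n + 1) 0 - preHilbertPoly ℚ (n + 1) d := by
  have h1 : ∀ t : ℕ, d ≤ t + n + 1 → (cardFun A t : ℚ) =
      (preHilbertPoly ℚ (n + 1) 0 - preHilbertPoly ℚ (n + 1) d).eval (t : ℚ) := by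
    intro t ht
    rw [eval_sub, eval_preHilbertPoly_of_le (by omega), eval_preHilbertPoly_of_le (by omega),
      Nat.sub_zero, ← add_assoc]
    exact_mod_cast h t ht
  refine ⟨h1, eventualPoly_eq ?_⟩
  filter_upwards [Filter.eventually_ge_atTop d] with t ht
  exact h1 t (by omega)

theorem phaseTransition_eq_sub
    (hlt : ∀ t, t + n + 1 < d → cardFun A t = (t + n + 1).choose (n + 1))
    (hge : ∀ t, d ≤ t + n + 1 → (cardFun A t : ℤ) =
      ((t + n + 1).choose (n + 1) : ℤ) - ((t + n + 1 - d).choose (n + 1) : ℤ)) :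
    phaseTransition A = d - (n + 1) := by
  obtain ⟨h1, h2⟩ := sumsetPoly_eq_sub hge
  refine le_antisymm (Nat.sInf_le fun t ht => ?_)
    (le_csInf ⟨d - (n + 1), fun t ht => ?_⟩ fun N hN => ?_)
  · rw [h2]
    exact h1 t (by omega)
  · rw [h2]
    exact h1 t (by omega)
  · by_contra hlt'
    push Not at hlt'
    -- At the last integer before `d - n - 1` nothing is yet subtracted from the count, while the
    -- polynomial subtracts a nonzero value.
    obtain ⟨t, rfl⟩ : ∃ t, d = t + (n + 1) + 1 := ⟨d - (n + 1) - 1, by omega⟩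
    have h3 := hN t (by omega)
    rw [h2, eval_sub, eval_preHilbertPoly_of_le (Nat.zero_le _), hlt t (by omega), Nat.sub_zero,
      ← add_assoc] at h3
    exact eval_preHilbertPoly_ne_zero (n + 1) t (by rw [← add_assoc]; linarith)

open Filter Topology in
theorem tendsto_cardFun_div (hd : d ≠ 0)
    (hpoly : sumsetPoly A = ∑ j ∈ Finset.range d, preHilbertPoly ℚ n j)
    (hev : ∀ᶠ t : ℕ in atTop, (cardFun A t : ℚ) = (sumsetPoly A).eval (t : ℚ)) :
    Tendsto (fun t : ℕ => (cardFun A t : ℝ) / (t : ℝ) ^ n) atTop (𝓝 (d / n.factorial)) := by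
  set P := (sumsetPoly A).map (algebraMap ℚ ℝ)
  have hdeg : P.natDegree = n := by
    rw [natDegree_map, hpoly, natDegree_sum_preHilbertPoly hd]
  have hlead : P.leadingCoeff = d / n.factorial := by
    rw [leadingCoeff, hdeg, coeff_map, hpoly, coeff_sum_preHilbertPoly]
    simp
  have hP0 : P ≠ 0 := by
    rw [← leadingCoeff_ne_zero, hlead]
    exact div_ne_zero (by exact_mod_cast hd) (by exact_mod_cast n.factorial_ne_zero)
  have hlim := (Polynomial.div_tendsto_atTop_leadingCoeff_div_of_degree_eq P (X ^ n) (by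
    rw [degree_eq_natDegree hP0, hdeg, degree_X_pow])).comp
    (tendsto_natCast_atTop_atTop (R := ℝ))
  rw [leadingCoeff_X_pow, div_one, hlead] at hlim
  refine hlim.congr' ?_
  filter_upwards [hev] with t ht
  have : (cardFun A t : ℝ) = P.eval (t : ℝ) := by
    have h1 := congr_arg (algebraMap ℚ ℝ) ht
    rw [← Polynomial.eval_map_apply, map_natCast, map_natCast] at h1
    exact h1
  simp [this]

end HilbertPolynomials

/-! ### Sumsets and volumes -/

section Volume

open MeasureTheory Filter Topology
open scoped Pointwise

variable {n : ℕ} {A : Finset (Fin n → ℕ)}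

theorem sub_mem_diffSubgroup {a b : Fin n → ℕ} (ha : a ∈ A) (hb : b ∈ A) :
    (fun i => (a i : ℤ) - (b i : ℤ)) ∈ diffSubgroup A :=
  AddSubgroup.subset_closure ⟨a, ha, b, hb, rfl⟩

theorem exists_coeff_of_mem_diffSubgroup {x : Fin n → ℤ} (hx : x ∈ diffSubgroup A) :
    ∃ c : A → ℤ, ∑ a, c a = 0 ∧ ∀ i, ∑ a : A, c a * (a.1 i : ℤ) = x i := by
  classical
  induction hx using AddSubgroup.closure_induction with
  | mem x hx =>
    obtain ⟨a, ha, b, hb, rfl⟩ := hx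
    refine ⟨Pi.single ⟨a, ha⟩ 1 - Pi.single ⟨b, hb⟩ 1, ?_, fun i => ?_⟩
    · simp
    · simp [sub_mul, Pi.single_apply, ite_mul]
  | zero => exact ⟨0, by simp, by simp⟩
  | add x y _ _ hx hy =>
    obtain ⟨c, hc, hcx⟩ := hx
    obtain ⟨c', hc', hcy⟩ := hy
    exact ⟨c + c', by simp [Finset.sum_add_distrib, hc, hc', -Finset.univ_eq_attach],
      fun i => by simp [add_mul, Finset.sum_add_distrib, hcx, hcy, -Finset.univ_eq_attach]⟩
  | neg x _ hx =>
    obtain ⟨c, hc, hcx⟩ := hx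
    exact ⟨-c, by simp [hc, -Finset.univ_eq_attach],
      fun i => by simp [hcx, -Finset.univ_eq_attach]⟩

theorem exists_uniform_coeff_bound (a₀ : A) (B : Fin n → ℤ) (m : ℕ) :
    ∃ C : ℕ, ∀ (s : ℕ) (z : Fin n → ℤ), s ≤ m → 0 ≤ z → z ≤ B →
      (z - fun i => (s : ℤ) * (a₀.1 i : ℤ)) ∈ diffSubgroup A →
      ∃ c : A → ℤ, ∑ a, c a = s ∧ (∀ i, ∑ a : A, c a * (a.1 i : ℤ) = z i) ∧ ∀ a, -(C : ℤ) ≤ c a := by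
  classical
  have hex : ∀ (s : ℕ) (z : Fin n → ℤ), (z - fun i => (s : ℤ) * (a₀.1 i : ℤ)) ∈ diffSubgroup A →
      ∃ c : A → ℤ, ∑ a, c a = s ∧ ∀ i, ∑ a : A, c a * (a.1 i : ℤ) = z i := by
    intro s z hz
    obtain ⟨c, hc, hcz⟩ := exists_coeff_of_mem_diffSubgroup hz
    refine ⟨c + Pi.single a₀ (s : ℤ),
      by simp [Finset.sum_add_distrib, hc, -Finset.univ_eq_attach], fun i => ?_⟩
    simp [add_mul, Finset.sum_add_distrib, hcz, Pi.single_apply, ite_mul, -Finset.univ_eq_attach]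
  choose! c hc hcz using hex
  -- Only finitely many pairs `(s, z)` occur, so the sum of all absolute values of the chosen
  -- coefficients is a common bound. Pairs failing the lattice condition only enlarge it.
  refine ⟨∑ y ∈ Finset.range (m + 1) ×ˢ Finset.Icc 0 B, ∑ a, (c y.1 y.2 a).natAbs,
    fun s z hs h0 hB hz => ⟨c s z, hc s z hz, hcz s z hz, fun a => ?_⟩⟩
  have h1 : (c s z a).natAbs ≤ ∑ a, (c s z a).natAbs :=
    Finset.single_le_sum (f := fun a => (c s z a).natAbs) (fun _ _ => Nat.zero_le _)
      (Finset.mem_univ a)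
  have h2 : ∑ a, (c s z a).natAbs ≤
      ∑ y ∈ Finset.range (m + 1) ×ˢ Finset.Icc 0 B, ∑ a, (c y.1 y.2 a).natAbs :=
    Finset.single_le_sum (f := fun y : ℕ × (Fin n → ℤ) => ∑ a, (c y.1 y.2 a).natAbs)
      (fun _ _ => Nat.zero_le _) (a := (s, z)) (by simp; exact ⟨by omega, h0, hB⟩)
  omega

theorem mem_realHull_iff {x : Fin n → ℝ} :
    x ∈ realHull A ↔
      ∃ l : A → ℝ, (∀ a, 0 ≤ l a) ∧ ∑ a, l a = 1 ∧ ∀ i, ∑ a : A, l a * (a.1 i : ℝ) = x i := by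
  constructor
  · intro hx
    let F := Fintype.linearCombination ℝ fun (a : A) (i : Fin n) => (a.1 i : ℝ)
    have hsub : realHull A ⊆ F '' stdSimplex ℝ A := by
      refine convexHull_min ?_ ((convex_stdSimplex ℝ A).linear_image F)
      rintro _ ⟨a, ha, rfl⟩
      exact ⟨Pi.single ⟨a, ha⟩ 1, single_mem_stdSimplex ℝ _, by simp [F]⟩
    obtain ⟨l, ⟨h0, h1⟩, rfl⟩ := hsub hx
    exact ⟨l, h0, h1, fun i => by simp [F, Fintype.linearCombination_apply]⟩
  · rintro ⟨l, h0, h1, hx⟩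
    have : x = ∑ a : A, l a • (fun i => (a.1 i : ℝ)) := by
      ext i
      simp [← hx i]
    rw [this]
    exact (convex_convexHull ℝ _).sum_mem (fun a _ => h0 a) h1
      fun a _ => subset_convexHull ℝ _ ⟨a.1, a.2, rfl⟩

/-- A lattice point of `t • conv(A)` becomes an element of a sumset after a translation which does
not depend on the point and on `t`. -/
theorem exists_translate_mem_sumset (a₀ : A) :
    ∃ C : ℕ, ∀ (t : ℕ) (x : Fin n → ℤ) (l : A → ℝ), (∀ a, 0 ≤ l a) → ∑ a, l a = t →
      (∀ i, ∑ a : A, l a * (a.1 i : ℝ) = x i) →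
      (x - fun i => (t : ℤ) * (a₀.1 i : ℤ)) ∈ diffSubgroup A →
      ∃ b ∈ sumset A (t + C * A.card), ∀ i, (b i : ℤ) = x i + C * ∑ a : A, (a.1 i : ℤ) := by
  obtain ⟨C, hC⟩ := exists_uniform_coeff_bound a₀ (fun i => ∑ a : A, (a.1 i : ℤ)) A.card
  refine ⟨C, fun t x l hl0 hlt hlx hx => ?_⟩
  -- Rounding down leaves a remainder `z` in a fixed box, of weight `s ≤ A.card`. It has integral
  -- coefficients bounded below by `-C`, and adding `C` to every coefficient makes them nonnegative.
  set m : A → ℕ := fun a => ⌊l a⌋₊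
  set z : Fin n → ℤ := fun i => x i - ∑ a : A, (m a : ℤ) * (a.1 i : ℤ)
  have hfl : ∀ a, (m a : ℝ) ≤ l a := fun a => Nat.floor_le (hl0 a)
  have hfu : ∀ a, l a ≤ m a + 1 := fun a => (Nat.lt_floor_add_one (l a)).le
  have hmt : ∑ a, m a ≤ t := by
    have : (∑ a, (m a : ℝ)) ≤ t := by
      rw [← hlt]
      exact Finset.sum_le_sum fun a _ => hfl a
    exact_mod_cast this
  have hmt' : t ≤ ∑ a, m a + A.card := by
    have : (t : ℝ) ≤ ∑ a, (m a : ℝ) + A.card := by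
      rw [← hlt]
      calc ∑ a, l a ≤ ∑ a : A, ((m a : ℝ) + 1) := Finset.sum_le_sum fun a _ => hfu a
        _ = _ := by simp [Finset.sum_add_distrib]
    exact_mod_cast this
  obtain ⟨s, rfl⟩ := Nat.exists_eq_add_of_le hmt
  have hz : ∀ i, (z i : ℝ) = ∑ a : A, (l a - m a) * (a.1 i : ℝ) := by
    intro i
    simp only [z, sub_mul, Finset.sum_sub_distrib, hlx]
    push_cast
    rfl
  have hz0 : 0 ≤ z := by
    intro i
    have : (0 : ℝ) ≤ z i := by
      rw [hz]
      exact Finset.sum_nonneg fun a _ => mul_nonneg (sub_nonneg.2 (hfl a)) (Nat.cast_nonneg _)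
    exact_mod_cast this
  have hzB : z ≤ fun i => ∑ a : A, (a.1 i : ℤ) := by
    intro i
    have : (z i : ℝ) ≤ ∑ a : A, (a.1 i : ℝ) := by
      rw [hz]
      refine Finset.sum_le_sum fun a _ => mul_le_of_le_one_left (Nat.cast_nonneg _) ?_
      linarith [hfu a]
    exact_mod_cast this
  have hzmem : (z - fun i => (s : ℤ) * (a₀.1 i : ℤ)) ∈ diffSubgroup A := by
    -- With `t = ∑ m a + s`, the vector `z - s a₀` is `x - t a₀` plus the sum of the `m a • (a₀ -
    -- a)`.
    have h1 : ∑ a : A, m a • (fun i => (a₀.1 i : ℤ) - (a.1 i : ℤ)) ∈ diffSubgroup A :=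
      sum_mem fun a _ => nsmul_mem (sub_mem_diffSubgroup a₀.2 a.2) _
    convert add_mem hx h1 using 1
    ext i
    simp only [z, Pi.sub_apply, Pi.add_apply, Finset.sum_apply, Pi.smul_apply, smul_sub,
      Finset.sum_sub_distrib, ← Finset.sum_smul]
    simp only [nsmul_eq_mul]
    push_cast
    ring
  obtain ⟨c, hcs, hcz, hcC⟩ := hC s z (by omega) hz0 hzB hzmem
  have hnat : ∀ a, ∃ k : ℕ, (k : ℤ) = m a + c a + C := fun a =>
    ⟨(m a + c a + C).toNat, Int.toNat_of_nonneg (by linarith [hcC a, Int.natCast_nonneg (m a)])⟩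
  choose k hk using hnat
  refine ⟨weightedSum A (Finsupp.equivFunOnFinite.symm k), (mem_sumset_iff A).2 ⟨_, ?_, rfl⟩,
    fun i => ?_⟩
  · rw [Finsupp.degree_eq_sum]
    zify
    simp only [Finsupp.equivFunOnFinite_symm_apply_apply, hk, Finset.sum_add_distrib, hcs]
    simp [mul_comm]
  · rw [weightedSum_apply]
    push_cast
    simp only [Finsupp.equivFunOnFinite_symm_apply_apply, hk, add_mul, Finset.sum_add_distrib, hcz,
      ← Finset.mul_sum, z]
    ring

/-- The embedding of `ℤⁿ` into `ℝⁿ`. -/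
def latticeEmbedding (n : ℕ) : (Fin n → ℤ) →+ (Fin n → ℝ) :=
  (Int.castAddHom ℝ).compLeft (Fin n)

@[simp]
theorem latticeEmbedding_apply (x : Fin n → ℤ) (i : Fin n) : latticeEmbedding n x i = x i := rfl

theorem latticeEmbedding_injective : Function.Injective (latticeEmbedding n) := by
  intro x y h
  ext i
  simpa using congr_fun h i

variable (A) in
/-- The lattice `ℤ(A - A)` in `ℝⁿ`. -/
def diffLattice : Submodule ℤ (Fin n → ℝ) :=
  AddSubgroup.toIntSubmodule ((diffSubgroup A).map (latticeEmbedding n))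

theorem mem_diffLattice {y : Fin n → ℝ} :
    y ∈ diffLattice A ↔ ∃ x ∈ diffSubgroup A, latticeEmbedding n x = y := Iff.rfl

theorem toAddSubgroup_span_basisFun :
    (Submodule.span ℤ (Set.range (Pi.basisFun ℝ (Fin n)))).toAddSubgroup =
      (⊤ : AddSubgroup (Fin n → ℤ)).map (latticeEmbedding n) := by
  ext y
  rw [Submodule.mem_toAddSubgroup, Module.Basis.mem_span_iff_repr_mem]
  simp only [Pi.basisFun_repr, AddSubgroup.mem_map, AddSubgroup.mem_top, true_and]
  constructor
  · intro h
    choose x hx using h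
    exact ⟨x, funext fun i => by simpa using hx i⟩
  · rintro ⟨x, rfl⟩ i
    exact ⟨x i, by simp⟩

theorem diffLattice_le : diffLattice A ≤ Submodule.span ℤ (Set.range (Pi.basisFun ℝ (Fin n))) := by
  intro y hy
  rw [← Submodule.mem_toAddSubgroup, toAddSubgroup_span_basisFun]
  obtain ⟨x, -, rfl⟩ := mem_diffLattice.1 hy
  exact ⟨x, trivial, rfl⟩

instance discreteTopology_diffLattice : DiscreteTopology (diffLattice A) :=
  @DiscreteTopology.of_subset _ _ _ _
    (inferInstance : DiscreteTopology (Submodule.span ℤ (Set.range (Pi.basisFun ℝ (Fin n)))))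
    diffLattice_le

/-- A linear functional that kills all the differences is constant on `A`, hence zero. -/
theorem AffinelySpans.span_diff_eq_top (h : AffinelySpans A) (a₀ : A) :
    Submodule.span ℚ (Set.range fun (a : A) (i : Fin n) => (a.1 i : ℚ) - (a₀.1 i : ℚ)) = ⊤ := by
  by_contra hne
  obtain ⟨f, hf0, hf⟩ := Submodule.exists_le_ker_of_lt_top _ (lt_top_iff_ne_top.2 hne)
  have hfw : ∀ y : Fin n → ℚ, f y = ∑ i, f (Pi.single i 1) * y i := by
    intro y
    conv_lhs => rw [pi_eq_sum_univ' y]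
    simp [mul_comm]
  have hw := h (fun i => f (Pi.single i 1)) (f fun i => (a₀.1 i : ℚ)) fun a ha => by
    rw [← hfw, ← sub_eq_zero, ← map_sub]
    exact hf (Submodule.subset_span ⟨⟨a, ha⟩, rfl⟩)
  refine hf0 (LinearMap.ext fun y => ?_)
  rw [hfw]
  simp [fun i => congr_fun hw i]

theorem AffinelySpans.isZLattice (h : AffinelySpans A) (hA : A.Nonempty) :
    IsZLattice ℝ (diffLattice A) := by
  obtain ⟨a₀, ha₀⟩ := hA
  refine ⟨eq_top_iff.2 ?_⟩
  let φ : (Fin n → ℚ) →ₗ[ℚ] (Fin n → ℝ) := (Algebra.linearMap ℚ ℝ).compLeft (Fin n)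
  have hle : Submodule.map φ
      (Submodule.span ℚ (Set.range fun (a : A) (i : Fin n) => (a.1 i : ℚ) - (a₀ i : ℚ))) ≤
      (Submodule.span ℝ (diffLattice A : Set (Fin n → ℝ))).restrictScalars ℚ := by
    rw [Submodule.map_span_le]
    rintro _ ⟨a, rfl⟩
    refine Submodule.subset_span (mem_diffLattice.2
      ⟨_, sub_mem_diffSubgroup a.2 ha₀, ?_⟩)
    ext i
    simp [φ]
  rw [h.span_diff_eq_top ⟨a₀, ha₀⟩] at hle
  rw [← (Pi.basisFun ℝ (Fin n)).span_eq, Submodule.span_le]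
  rintro _ ⟨i, rfl⟩
  have := hle ⟨Pi.single i 1, trivial, rfl⟩
  have hφ : φ (Pi.single i 1) = Pi.basisFun ℝ (Fin n) i := by
    ext j
    simp [φ, Pi.single_apply, apply_ite]
  rwa [hφ] at this

/-- The covolume of a sublattice relative to `ℤⁿ`, which has covolume one, is its index. -/
theorem AffinelySpans.covolume_diffLattice (h : AffinelySpans A) (hA : A.Nonempty) :
    ZLattice.covolume (diffLattice A) = (diffSubgroup A).index := by
  have := h.isZLattice hA
  have h1 : ZLattice.covolume (Submodule.span ℤ (Set.range (Pi.basisFun ℝ (Fin n)))) = 1 := by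
    rw [ZLattice.covolume_eq_measure_fundamentalDomain _ _ (ZSpan.isAddFundamentalDomain _ volume),
      ZSpan.fundamentalDomain_pi_basisFun]
    simp [measureReal_def, Real.volume_pi_Ico]
  have h2 := ZLattice.covolume_div_covolume_eq_relIndex (diffLattice A) _ diffLattice_le
  rw [h1, div_one, toAddSubgroup_span_basisFun] at h2
  rw [h2]
  change (((diffSubgroup A).map (latticeEmbedding n)).relIndex _ : ℝ) = _
  rw [AddSubgroup.relIndex_map_map_of_injective _ _ latticeEmbedding_injective,
    AddSubgroup.relIndex_top_right]

theorem tendsto_shift_div {f : ℕ → ℝ} {δ : ℝ}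
    (hf : Tendsto (fun t : ℕ => f t / (t : ℝ) ^ n) atTop (𝓝 δ)) (C : ℕ) :
    Tendsto (fun t : ℕ => f (t + C) / (t : ℝ) ^ n) atTop (𝓝 δ) := by
  have h1 := hf.comp (tendsto_add_atTop_nat C)
  have h2 : Tendsto (fun t : ℕ => ((t + C : ℕ) : ℝ) / (t : ℝ)) atTop (𝓝 1) := by
    have h3 := (tendsto_const_div_atTop_nhds_zero_nat (C : ℝ)).const_add 1
    rw [add_zero] at h3
    refine h3.congr' ?_
    filter_upwards [eventually_gt_atTop 0] with t ht
    have : (t : ℝ) ≠ 0 := by exact_mod_cast ht.ne'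
    push_cast
    field_simp
  have h4 := h1.mul (h2.pow n)
  rw [one_pow, mul_one] at h4
  refine h4.congr' ?_
  filter_upwards [eventually_gt_atTop 0] with t ht
  have h5 : (t : ℝ) ≠ 0 := by exact_mod_cast ht.ne'
  have h6 : ((t + C : ℕ) : ℝ) ≠ 0 := by positivity
  simp only [Function.comp_apply, div_pow]
  field_simp

/-- Translating by `t a₀` and scaling by `1 / t` embeds `tA` in the lattice points of the translated
hull. Conversely, `exists_translate_mem_sumset` recovers every such point from an element of `(t +
C)A`. -/
theorem card_lattice_points_bounds (a₀ : A) : ∃ C : ℕ, ∀ t : ℕ, 0 < t →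
    cardFun A t ≤ Nat.card (((fun x => x + fun i => (a₀.1 i : ℝ)) ⁻¹' realHull A ∩
      (t : ℝ)⁻¹ • (diffLattice A : Set (Fin n → ℝ)) : Set (Fin n → ℝ))) ∧
    Nat.card (((fun x => x + fun i => (a₀.1 i : ℝ)) ⁻¹' realHull A ∩
      (t : ℝ)⁻¹ • (diffLattice A : Set (Fin n → ℝ)) : Set (Fin n → ℝ))) ≤ cardFun A (t + C) := by
  obtain ⟨C, hC⟩ := exists_translate_mem_sumset a₀
  refine ⟨C * A.card, fun t ht => ?_⟩
  have ht0 : (t : ℝ) ≠ 0 := by exact_mod_cast ht.ne'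
  set S : Set (Fin n → ℝ) := (fun x => x + fun i => (a₀.1 i : ℝ)) ⁻¹' realHull A ∩
      (t : ℝ)⁻¹ • (diffLattice A : Set (Fin n → ℝ))
  let g : (Fin n → ℕ) → (Fin n → ℝ) := fun b i => (t : ℝ)⁻¹ * (b i - t * a₀.1 i)
  let g' : (Fin n → ℕ) → (Fin n → ℝ) := fun b i =>
    (t : ℝ)⁻¹ * (b i - t * a₀.1 i - C * ∑ a : A, (a.1 i : ℝ))
  have hg : g '' sumset A t ⊆ S := by
    rintro _ ⟨b, hb, rfl⟩
    obtain ⟨v, hv, rfl⟩ := (mem_sumset_iff A).1 hb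
    have hv' : ∑ a, (v a : ℝ) = t := by
      rw [← hv, Finsupp.degree_eq_sum]
      push_cast
      rfl
    refine ⟨mem_realHull_iff.2 ⟨fun a => (t : ℝ)⁻¹ * v a, fun a => by positivity, ?_, fun i => ?_⟩,
      Set.mem_smul_set.2 ⟨latticeEmbedding n
        (∑ a : A, v a • fun i => (a.1 i : ℤ) - (a₀.1 i : ℤ)), ⟨_, ?_, rfl⟩, ?_⟩⟩
    · rw [← Finset.mul_sum, hv', inv_mul_cancel₀ ht0]
    · simp only [g, Pi.add_apply, weightedSum_apply, mul_assoc, ← Finset.mul_sum]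
      push_cast
      field_simp
      ring
    · exact sum_mem fun a _ => nsmul_mem
        (sub_mem_diffSubgroup a.2 a₀.2) _
    · ext i
      simp only [g, Pi.smul_apply, smul_eq_mul, latticeEmbedding_apply, weightedSum_apply,
        Finset.sum_apply, nsmul_eq_mul, mul_sub, ← hv']
      push_cast
      simp [mul_sub, Finset.sum_sub_distrib, Finset.sum_mul]
  have hg' : S ⊆ g' '' sumset A (t + C * A.card) := by
    rintro y ⟨hy, hyL⟩
    obtain ⟨l, hl0, hl1, hly⟩ := mem_realHull_iff.1 hy
    obtain ⟨_, ⟨x, hx, rfl⟩, rfl⟩ := Set.mem_smul_set.1 hyL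
    obtain ⟨b, hb, hbx⟩ := hC t (x + fun i => (t : ℤ) * (a₀.1 i : ℤ)) (fun a => t * l a)
      (fun a => mul_nonneg (Nat.cast_nonneg _) (hl0 a)) (by rw [← Finset.mul_sum, hl1, mul_one])
      (fun i => by
        simp only [mul_assoc, ← Finset.mul_sum, hly]
        simp only [Pi.add_apply, Pi.smul_apply, smul_eq_mul, latticeEmbedding_apply]
        push_cast
        field_simp) (by simpa using hx)
    refine ⟨b, hb, ?_⟩
    ext i
    have h1 : (b i : ℝ) = x i + t * a₀.1 i + C * ∑ a : A, (a.1 i : ℝ) := by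
      have := congr_arg (Int.cast (R := ℝ)) (hbx i)
      push_cast [Pi.add_apply] at this
      exact this
    simp only [g', h1, Pi.smul_apply, smul_eq_mul, latticeEmbedding_apply]
    ring
  have hfin : S.Finite := ((Finset.finite_toSet _).image g').subset hg'
  have hginj : Function.Injective g := by
    intro b b' hbb
    ext i
    have h1 := mul_left_cancel₀ (inv_ne_zero ht0) (congr_fun hbb i)
    have h2 : (b i : ℝ) = b' i := by linarith
    exact_mod_cast h2
  rw [Nat.card_coe_set_eq]
  constructor
  · rw [cardFun, ← Set.ncard_coe_finset, ← Set.ncard_image_of_injective _ hginj]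
    exact Set.ncard_le_ncard hg hfin
  · rw [cardFun, ← Set.ncard_coe_finset]
    exact (Set.ncard_le_ncard hg' ((Finset.finite_toSet _).image g')).trans
      (Set.ncard_image_le (Finset.finite_toSet _))

theorem isCompact_realHull : IsCompact (realHull A) := by
  refine Set.Finite.isCompact_convexHull ℝ ?_
  have : {x : Fin n → ℝ | ∃ a ∈ A, x = fun i => (a i : ℝ)} =
      (fun (a : Fin n → ℕ) (i : Fin n) => (a i : ℝ)) '' A := by
    ext x
    simp [eq_comm]
  rw [this]
  exact A.finite_toSet.image _

/-- The normalized asymptotic cardinality of the sumsets is the volume of the convex hull, measured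
with respect to the lattice generated by the differences. -/
theorem AffinelySpans.volume_div_index_eq (h : AffinelySpans A) (hA : A.Nonempty) {δ : ℝ}
    (hδ : Tendsto (fun t : ℕ => (cardFun A t : ℝ) / (t : ℝ) ^ n) atTop (𝓝 δ)) :
    volume.real (realHull A) / ((diffSubgroup A).index : ℝ) = δ := by
  obtain ⟨a, ha⟩ := hA
  let a₀ : A := ⟨a, ha⟩
  have := h.isZLattice ⟨a, ha⟩
  set s : Set (Fin n → ℝ) := (fun x => x + fun i => (a₀.1 i : ℝ)) ⁻¹' realHull A
  have hcomp : IsCompact s :=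
    (Homeomorph.addRight fun i => (a₀.1 i : ℝ)).isCompact_preimage.2 isCompact_realHull
  have hconv : Convex ℝ s := (convex_convexHull ℝ _).translate_preimage_left _
  have hvol : volume.real s = volume.real (realHull A) := by
    rw [measureReal_def, measureReal_def, measure_preimage_add_right]
  -- The count of lattice points requires a null frontier, which convexity supplies. The two sumset
  -- bounds then squeeze the same quantity.
  have hlim := ZLattice.covolume.tendsto_card_div_pow (diffLattice A)
    (IsZLattice.basis (diffLattice A)) hcomp.isBounded hcomp.isClosed.measurableSet
    (hconv.addHaar_frontier volume)
  rw [hvol, h.covolume_diffLattice ⟨a, ha⟩, Fintype.card_fin] at hlim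
  obtain ⟨C, hC⟩ := card_lattice_points_bounds a₀
  refine tendsto_nhds_unique hlim (tendsto_of_tendsto_of_tendsto_of_le_of_le' hδ
    (tendsto_shift_div hδ C) ?_ ?_)
  · filter_upwards [eventually_gt_atTop 0] with t ht
    exact div_le_div_of_nonneg_right (by exact_mod_cast (hC t ht).1) (by positivity)
  · filter_upwards [eventually_gt_atTop 0] with t ht
    exact div_le_div_of_nonneg_right (by exact_mod_cast (hC t ht).2) (by positivity)

end Volume

/-! ### The cases of `n + 1` and `n + 2` points -/

section SmallCardinality

variable {n : ℕ} {A : Finset (Fin n → ℕ)}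

theorem AffinelySpans.cardFun_eq_choose (h : AffinelySpans A) (hcard : A.card = n + 1) (t : ℕ) :
    cardFun A t = (t + n).choose n := by
  refine cardFun_of_injective hcard (fun v w hdeg hsum => Finsupp.ext fun a => ?_) t
  have h0 := h.eq_zero_of_isRelation hcard (isRelation_sub_iff.2 ⟨hdeg, hsum⟩).intCast
  have h1 := congr_fun h0 a
  push_cast at h1
  rw [Pi.zero_apply, sub_eq_zero] at h1
  exact_mod_cast h1

theorem cardFun_eq_choose_of_lt {p q : A →₀ ℕ} (h : IsGeneratingMove (homExponent A) p q)
    (hdeg : p.degree = q.degree) (hcard : A.card = n + 2) {t : ℕ} (ht : t + n + 1 < p.degree) :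
    cardFun A t = (t + n + 1).choose (n + 1) :=
  cardFun_of_lt h hdeg hcard (by omega)

theorem cardFun_eq_choose_sub {p q : A →₀ ℕ} (h : IsGeneratingMove (homExponent A) p q)
    (hdeg : p.degree = q.degree) (hcard : A.card = n + 2) {t : ℕ} (ht : p.degree ≤ t + n + 1) :
    (cardFun A t : ℤ) =
      ((t + n + 1).choose (n + 1) : ℤ) - ((t + n + 1 - p.degree).choose (n + 1) : ℤ) := by
  -- Below the degree no monomial is divisible by `x^p`, and the subtracted binomial is zero because
  -- its upper entry is at most `n`.
  rcases lt_or_ge t p.degree with hlt | hge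
  · rw [cardFun_of_lt h hdeg hcard hlt, Nat.choose_eq_zero_of_lt (n := t + n + 1 - p.degree)
      (by omega)]
    simp [add_assoc]
  · obtain ⟨s, rfl⟩ := Nat.exists_eq_add_of_le' hge
    have h1 := cardFun_add_of_le h hdeg hcard s
    rw [show s + p.degree + n + 1 - p.degree = s + (n + 1) by omega, add_assoc _ n 1, ← h1]
    push_cast
    ring

theorem degree_monomialVariety (K : Type*) [Field K] [Infinite K] (hA : A.Nonempty)
    (hdim : topologicalKrullDim (monomialVariety K A) = (n : WithBot ℕ∞)) {d : ℕ} (hd : d ≠ 0)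
    (hpoly : sumsetPoly A = ∑ j ∈ Finset.range d, preHilbertPoly ℚ n j) :
    degree (monomialVariety K A) = d := by
  have h1 : hilbertPoly (monomialVariety K A) = sumsetPoly A := by
    rw [hilbertPoly, hilbertFun_monomialVariety A K hA, sumsetPoly]
  have h2 : (WithBot.unbotD 0 (n : WithBot ℕ∞)).toNat = n := rfl
  rw [degree, hdim, h1, hpoly, leadingCoeff, natDegree_sum_preHilbertPoly hd,
    coeff_sum_preHilbertPoly, h2]
  have : (n.factorial : ℚ) ≠ 0 := by exact_mod_cast n.factorial_ne_zero
  field_simp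

end SmallCardinality

end SumsetVariety

end

theorem proposition3p6 {K : Type*} [Field K] [IsAlgClosed K] [CharZero K]
    {n : ℕ} (hn : 1 ≤ n) (A : Finset (Fin n → ℕ))
    (hdim : topologicalKrullDim (SumsetVariety.monomialVariety K A) = (n : WithBot ℕ∞)) :
    (A.card = n + 1 →
      (∀ t : ℕ, SumsetVariety.cardFun A t = (t + n).choose n ∧
        (SumsetVariety.sumsetPoly A).eval (t : ℚ) = ((t + n).choose n : ℚ)) ∧
      SumsetVariety.phaseTransition A = 0) ∧
    (A.card = n + 2 →
      ∃ d : ℕ,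
        SumsetVariety.degree (SumsetVariety.monomialVariety K A) = (d : ℚ) ∧
        SumsetVariety.IsHypersurface (SumsetVariety.monomialVariety K A) d ∧
        -- truncated subtraction: this is `max (d - n - 1) 0`
        SumsetVariety.phaseTransition A = d - (n + 1) ∧
        (∀ t : ℕ, t + n + 1 < d →
          SumsetVariety.cardFun A t = (t + n + 1).choose (n + 1)) ∧
        (∀ t : ℕ, d ≤ t + n + 1 →
          (SumsetVariety.cardFun A t : ℤ) =
            ((t + n + 1).choose (n + 1) : ℤ) - ((t + n + 1 - d).choose (n + 1) : ℤ)) ∧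
        (d : ℝ) = (n.factorial : ℝ) *
          (MeasureTheory.volume.real (SumsetVariety.realHull A) /
            ((SumsetVariety.diffSubgroup A).index : ℝ))) := by
  open SumsetVariety in
  refine ⟨fun hcard => ?_, fun hcard => ?_⟩
  · have hA : A.Nonempty := Finset.card_pos.1 (by omega)
    have hspan := affinelySpans_of_topologicalKrullDim A K hn hA hdim.ge
    have hcount := hspan.cardFun_eq_choose hcard
    have heval : ∀ t : ℕ, (sumsetPoly A).eval (t : ℚ) = ((t + n).choose n : ℚ) := fun t => by
      rw [sumsetPoly_eq_of_choose hcount, eval_preHilbertPoly_of_le (Nat.zero_le _), Nat.sub_zero]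
    exact ⟨fun t => ⟨hcount t, heval t⟩,
      phaseTransition_eq_zero fun t => by rw [heval, hcount]⟩
  · have hA : A.Nonempty := Finset.card_pos.1 (by omega)
    have hspan := affinelySpans_of_topologicalKrullDim A K hn hA hdim.ge
    obtain ⟨u, hu0, hu, hgen⟩ := hspan.exists_primitive_relation hcard
    obtain ⟨p, q, h, hdeg⟩ := exists_isGeneratingMove (by omega) hu0 hu hgen
    have hd : p.degree ≠ 0 := fun h0 => h.ne_zero ((Finsupp.degree_eq_zero_iff p).1 h0)
    have hlt := fun t => cardFun_eq_choose_of_lt h hdeg hcard (t := t)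
    have hge := fun t => cardFun_eq_choose_sub h hdeg hcard (t := t)
    obtain ⟨heval, hpoly⟩ := sumsetPoly_eq_sub hge
    have hsum := hpoly.trans (preHilbertPoly_zero_sub n p.degree)
    refine ⟨p.degree, degree_monomialVariety K hA hdim hd hsum,
      isHypersurface_monomialVariety K hA h hdeg, phaseTransition_eq_sub hlt hge, hlt, hge, ?_⟩
    -- Both the volume over the index and `d / n!` are limits of `|tA| / t ^ n`.
    rw [hspan.volume_div_index_eq hA (tendsto_cardFun_div hd hsum ?_)]
    · have : (n.factorial : ℝ) ≠ 0 := by exact_mod_cast n.factorial_ne_zero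
      field_simp
    · filter_upwards [Filter.eventually_ge_atTop p.degree] with t ht
      rw [hpoly]
      exact heval t (by omega)
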